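/- Let $G$ be a meromorphic function on $\mathbb{C}$ all of whose poles and zeroes are simple. Suppose that the poles of $G$ are enumerated, without repetition, as $\omega^+_{m,j}$ ($m=1,2,\dots$; $j=1,\dots,M_+$), and its zeroes, without repetition, as $\omega^-_{m,j}$ ($m=1,2,\dots$; $j=1,\dots,M_-$), where for each branch there is $\epsilon>0$ such that $$\omega^\pm_{m,j}=d^\pm_j\,(m+\xi^\pm_j)+O(m^{-\epsilon})\qquad(m\to\infty),$$ with complex $d_j^\pm\neq 0$ and $\xi_j^\pm$. Suppose that the branches are non-overlapping, i.e. $\operatorname{Im}(d^+_j/d^+_{j'})\ne0$ and $\operatorname{Im}(d^-_j/d^-_{j'})\neq 0$ for $j\ne j'$. Suppose that $G$ has power-law asymptotics in the following sense: there are radii $R_N>0$, $R_N\to\infty$, such that no pole or zero of $G$ lies on a circle $|\omega|=R_N$, such that for every unit complex number $u$ with $\arg u\neq\arg d_j^\pm$ for all $j$ (and both signs) there is a constant $C_u$ with $$\left|\frac{G'(R_Nu)}{G(R_Nu)}\right|\le \frac{C_u}{R_N}\qquad\text{for all }N,$$ and such that $\max_{|\omega|=R_N}|G'(\omega)/G(\omega)|\le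 C R_N^{k}$ for all $N$, for some constants $C$ and $k\in\mathbb{N}$. (Both bounds hold in particular if $R_N$ is increasing and $\max_{|\omega|=R_N}|G'/G|\le C/R_N$ for all $N$.) Then the branches match: $M_+=M_-$ and, after relabelling the branches of zeroes, $d_j^+=d_j^-=:d_j$ for all $j$. Moreover, with $$\sigma=\sum_j(\xi_j^--\xi_j^+),$$ one has $G(\omega)\sim\omega^{-\sigma}$ (up to a non-zero constant factor) as $|\omega|\to\infty$, uniformly in every closed sector that contains no branch direction: if $\alpha,\beta\in\mathbb R$ are such that $\arg e^{i\varphi}\ne\arg d_j$ for all $\varphi\in[\alpha,\beta]$ and all $j$, then there is a constant $K\neq0$ such that $$G(re^{i\varphi})\,e^{\sigma(\log r+i\varphi)}\longrightarrow K\qquad (r\to+\infty)$$ uniformly in $\varphi\in[\alpha,\beta]$. The exponent $\sigma$ is the same in all sectors; the constant $K$ may depend on the sector. -/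

import Mathlib

open Filter Topology Asymptotics

/-- `G` is a meromorphic function on `ℂ` all of whose poles and zeroes are simple. Normal form means
that removable singularities have been removed (and that the irrelevant value at a pole is `0`). -/
def IsMeromorphicSimple (G : ℂ → ℂ) : Prop :=
  MeromorphicNFOn G Set.univ ∧
    ∀ z, meromorphicOrderAt G z = -1 ∨ meromorphicOrderAt G z = 0 ∨ meromorphicOrderAt G z = 1

/-- The set of poles of `G`. -/
def poleSet (G : ℂ → ℂ) : Set ℂ := {z | meromorphicOrderAt G z < 0}

/-- The set of zeroes of `G`. -/
def zeroSet (G : ℂ → ℂ) : Set ℂ := {z | 0 < meromorphicOrderAt G z}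

/-- The asymptotic branch `ω_m = d (m + ξ) + O(m ^ (-ε))`, `m = 1, 2, …`, for some `ε > 0`, with
`d ≠ 0`. The term `ω_m` with `m ≥ 1` is stored as `ω (m - 1)`, hence the `m + 1` below. -/
def IsAsymptoticBranch (ω : ℕ → ℂ) (d ξ : ℂ) : Prop :=
  d ≠ 0 ∧ ∃ ε : ℝ, 0 < ε ∧
    (fun m : ℕ => ω m - d * ((m : ℂ) + 1 + ξ)) =O[atTop] (fun m : ℕ => ((m : ℝ) + 1) ^ (-ε))

/-- The set `S` is enumerated without repetition by the points `ω j m` of `M` asymptotic branches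
with parameters `d j`, `ξ j`, and these branches are non-overlapping: `Im (d j / d j') ≠ 0` for
`j ≠ j'`. -/
structure IsChristmasTree (S : Set ℂ) {M : ℕ} (ω : Fin M → ℕ → ℂ) (d ξ : Fin M → ℂ) : Prop where
  mem_iff : ∀ z, z ∈ S ↔ ∃ j m, ω j m = z
  injective : Function.Injective (fun p : Fin M × ℕ => ω p.1 p.2)
  branch : ∀ j, IsAsymptoticBranch (ω j) (d j) (ξ j)
  non_overlapping : ∀ j j', j ≠ j' → (d j / d j').im ≠ 0

/-- The direction `u` (a point of the unit circle) is not the direction of any of the branches. -/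
def OffBranches {M : ℕ} (d : Fin M → ℂ) (u : ℂ) : Prop := ∀ j, u.arg ≠ (d j).arg

/-- Power-law asymptotics of `G` away from the branch directions `dp`, `dm` of poles and zeroes:
there are radii `R N → ∞`, with no pole or zero of `G` on the circles `|z| = R N`, such that
`G' / G` is `O(1 / R N)` on these circles in each direction off the branches, the constant being
allowed to depend on the direction, while in the remaining directions `G' / G` is only required to
be at most of polynomial size in `R N`. -/
def HasPowerLawAsymptotics (G : ℂ → ℂ) {Mp Mm : ℕ} (dp : Fin Mp → ℂ) (dm : Fin Mm → ℂ) : Prop :=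
  ∃ R : ℕ → ℝ, (∀ N, 0 < R N) ∧ Tendsto R atTop atTop ∧
    (∀ N z, ‖z‖ = R N → meromorphicOrderAt G z = 0) ∧
    (∃ (C : ℝ) (k : ℕ), ∀ N z, ‖z‖ = R N → ‖logDeriv G z‖ ≤ C * R N ^ k) ∧
    ∀ u : ℂ, ‖u‖ = 1 → OffBranches dp u → OffBranches dm u →
      ∃ C : ℝ, ∀ N, ‖logDeriv G ((R N : ℂ) * u)‖ ≤ C / R N

/-- The bound `max_{|z| = R N} |G' / G| ≤ C / R N` on complete circles is a special case. -/
theorem HasPowerLawAsymptotics.of_circles (G : ℂ → ℂ) {Mp Mm : ℕ} (dp : Fin Mp → ℂ)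
    (dm : Fin Mm → ℂ) (R : ℕ → ℝ) (C : ℝ) (hpos : ∀ N, 0 < R N) (hR : Tendsto R atTop atTop)
    (hmono : StrictMono R) (hord : ∀ N z, ‖z‖ = R N → meromorphicOrderAt G z = 0)
    (hC : ∀ N z, ‖z‖ = R N → ‖logDeriv G z‖ ≤ C / R N) : HasPowerLawAsymptotics G dp dm := by
  refine ⟨R, hpos, hR, hord, ⟨|C| / R 0, 0, fun N z hz => ?_⟩, fun u hu _ _ => ⟨C, fun N => ?_⟩⟩
  · have h0 := hpos 0
    have h1 : R 0 ≤ R N := hmono.monotone (Nat.zero_le N)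
    calc ‖logDeriv G z‖ ≤ C / R N := hC N z hz
      _ ≤ |C| / R N := by gcongr; exacts [(hpos N).le, le_abs_self C]
      _ ≤ |C| / R 0 := by gcongr
      _ = |C| / R 0 * R N ^ 0 := by simp
  · apply hC
    simp [hu, abs_of_pos (hpos N)]

/-! The logarithmic derivative `f = G'/G` has only simple poles, with residue `1` at the zeroes and
`-1` at the poles of `G`. Each branch stays within bounded distance of an arithmetic progression, so
its principal parts converge once the counterterms `1 / (d (m + 1))` are added. Subtracting the
signed branch sums from `f` leaves an entire function. Its Cauchy integrals of high order over the
circles `|z| = R N` tend to `0`: `f` grows at most polynomially there, and each branch sum is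
controlled by integrating its terms exactly. Hence the difference is a polynomial
(`exists_partialFraction`).

Along a ray in a direction `u` off the branch, a branch sum is `d⁻¹ (log r + log (-(u / d)) + γ) +
o(1)`, as for the digamma function (`exists_branchSum_linear_le`,
`IsAsymptoticBranch.tendsto_branchSum_ray`). Since `f (R N * u) → 0`, the polynomial is a constant,
the `log r` terms cancel, and the constant plus a combination of `log (-(u / d j))` vanishes for
every admissible `u` (`Polynomial.eq_C_of_tendsto_add_log`). When `u` crosses a branch direction the
logarithm jumps by `2πi`, so the signed sum of `1 / d j` over the branches in that direction is zero
(`sum_div_eq_zero_of_log_relation`). Non-overlap allows at most one branch of each kind per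
direction, hence the `d`'s agree in pairs, and the constant is then zero too.

What remains of `f` is a sum of differences of branch sums with a common `d`. Relative to the exact
progression, a shift `ξ` contributes `-ξ / z` up to `O(|z|^(-1-δ))`
(`IsAsymptoticBranch.exists_branchSum_sub_le`), so `z f(z) + σ` decays like a power. In the
coordinate `w = log z` this decay is integrable, and `G(e^w) e^(σw)` has a nonzero limit
(`exists_tendstoUniformlyOn_strip`). -/

/-! ### Branches and the convergence of their Mittag-Leffler sums -/

/-- The regularized principal part `1 / (z - a m) + 1 / (d (m + 1))` at the `m`-th point of a
branch. -/
noncomputable def branchTerm (a : ℕ → ℂ) (d : ℂ) (m : ℕ) (z : ℂ) : ℂ :=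
  (z - a m)⁻¹ + (d * ((m : ℂ) + 1))⁻¹

/-- The Mittag-Leffler sum `∑ m, (1 / (z - a m) + 1 / (d (m + 1)))` of a branch. -/
noncomputable def branchSum (a : ℕ → ℂ) (d : ℂ) (z : ℂ) : ℂ := ∑' m, branchTerm a d m z

theorem norm_natCast_add_one (m : ℕ) : ‖(m : ℂ) + 1‖ = (m : ℝ) + 1 := by
  exact_mod_cast Complex.norm_natCast (m + 1)

theorem summable_natCast_add_one_rpow_neg {s : ℝ} (hs : 1 < s) :
    Summable fun m : ℕ => ((m : ℝ) + 1) ^ (-s) := by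
  have h := (summable_nat_add_iff 1).2 (Real.summable_nat_rpow.2 (neg_lt_neg hs))
  simpa using h

/-- The comparison sequence never vanishes, so a bound at infinity extends to all `m`. Lowering `ε`
to at most `1` only weakens the bound, and later lets errors of order `1 / (m + 1)` be absorbed into
`(m + 1) ^ (-ε)`. -/
theorem IsAsymptoticBranch.exists_rpow_bound {a : ℕ → ℂ} {d ξ : ℂ} (h : IsAsymptoticBranch a d ξ) :
    ∃ ε B : ℝ, 0 < ε ∧ ε ≤ 1 ∧ 0 ≤ B ∧
      ∀ m : ℕ, ‖a m - d * ((m : ℂ) + 1 + ξ)‖ ≤ B * ((m : ℝ) + 1) ^ (-ε) := by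
  obtain ⟨-, ε, hε, hO⟩ := h
  obtain ⟨C, hC⟩ := (Asymptotics.isBigO_nat_atTop_iff
    (fun m hm => absurd hm (by positivity))).1 hO
  refine ⟨min ε 1, |C|, by positivity, min_le_right _ _, abs_nonneg _, fun m => (hC m).trans ?_⟩
  have h1 : (1 : ℝ) ≤ (m : ℝ) + 1 := by linarith [(Nat.cast_nonneg m : (0 : ℝ) ≤ m)]
  rw [Real.norm_of_nonneg (by positivity)]
  gcongr
  · exact le_abs_self C
  · exact min_le_left _ _

theorem IsAsymptoticBranch.exists_bound {a : ℕ → ℂ} {d ξ : ℂ} (h : IsAsymptoticBranch a d ξ) :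
    ∃ B : ℝ, 0 ≤ B ∧ ∀ m : ℕ, ‖a m - d * ((m : ℂ) + 1)‖ ≤ B := by
  obtain ⟨ε, B, hε, -, hB, hb⟩ := h.exists_rpow_bound
  refine ⟨B + ‖d * ξ‖, by positivity, fun m => ?_⟩
  have h1 : (1 : ℝ) ≤ (m : ℝ) + 1 := by linarith [(Nat.cast_nonneg m : (0 : ℝ) ≤ m)]
  have h2 : ((m : ℝ) + 1) ^ (-ε) ≤ 1 := Real.rpow_le_one_of_one_le_of_nonpos h1 (by linarith)
  calc ‖a m - d * ((m : ℂ) + 1)‖ = ‖(a m - d * ((m : ℂ) + 1 + ξ)) + d * ξ‖ := by ring_nf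
    _ ≤ ‖a m - d * ((m : ℂ) + 1 + ξ)‖ + ‖d * ξ‖ := norm_add_le _ _
    _ ≤ B * 1 + ‖d * ξ‖ := by gcongr; exact (hb m).trans (by gcongr)
    _ = B + ‖d * ξ‖ := by ring

/-- The exact arithmetic progression with step `d`. -/
theorem isAsymptoticBranch_linear {d : ℂ} (hd : d ≠ 0) :
    IsAsymptoticBranch (fun m => d * ((m : ℂ) + 1)) d 0 := by
  refine ⟨hd, 1, one_pos, ?_⟩
  simpa using Asymptotics.isBigO_zero _ _

section Estimates

variable {a : ℕ → ℂ} {d : ℂ} {B ρ : ℝ}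

theorem le_norm_sub_of_bound (hB : ∀ m : ℕ, ‖a m - d * ((m : ℂ) + 1)‖ ≤ B) {m : ℕ}
    (hm : 2 * (B + ρ) ≤ ‖d‖ * ((m : ℝ) + 1)) {z : ℂ} (hz : ‖z‖ ≤ ρ) :
    ‖d‖ * ((m : ℝ) + 1) / 2 ≤ ‖z - a m‖ := by
  have h1 : ‖d * ((m : ℂ) + 1)‖ = ‖d‖ * ((m : ℝ) + 1) := by rw [norm_mul, norm_natCast_add_one]
  have h2 : ‖d * ((m : ℂ) + 1)‖ ≤ ‖z‖ + ‖a m - d * ((m : ℂ) + 1)‖ + ‖z - a m‖ := by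
    calc ‖d * ((m : ℂ) + 1)‖ = ‖z - (a m - d * ((m : ℂ) + 1)) - (z - a m)‖ := by ring_nf
      _ ≤ _ := (norm_sub_le _ _).trans (by gcongr; exact norm_sub_le _ _)
  linarith [hB m]

/-- Over a common denominator the numerator is `z - (a m - d (m + 1))`, which is bounded, while both
factors of the denominator grow linearly in `m`. -/
theorem norm_branchTerm_le (hd : d ≠ 0) (hB : ∀ m : ℕ, ‖a m - d * ((m : ℂ) + 1)‖ ≤ B) {m : ℕ}
    (hρ : 0 < ρ) (hm : 2 * (B + ρ) ≤ ‖d‖ * ((m : ℝ) + 1)) {z : ℂ} (hz : ‖z‖ ≤ ρ) :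
    ‖branchTerm a d m z‖ ≤ 2 * (B + ρ) / ‖d‖ ^ 2 * ((m : ℝ) + 1) ^ (-2 : ℝ) := by
  have hB0 : 0 ≤ B := (norm_nonneg _).trans (hB 0)
  have h1 := le_norm_sub_of_bound hB hm hz
  have hd' : 0 < ‖d‖ := norm_pos_iff.2 hd
  have hm1 : (0 : ℝ) < (m : ℝ) + 1 := by positivity
  have h2 : z - a m ≠ 0 := norm_pos_iff.1 (lt_of_lt_of_le (by positivity) h1)
  have h3 : (m : ℂ) + 1 ≠ 0 := Nat.cast_add_one_ne_zero m
  have h4 : branchTerm a d m z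
      = (z - (a m - d * ((m : ℂ) + 1))) / ((z - a m) * (d * ((m : ℂ) + 1))) := by
    rw [branchTerm]; field_simp; ring
  rw [h4, norm_div, norm_mul, norm_mul, norm_natCast_add_one, Real.rpow_neg hm1.le, Real.rpow_two]
  calc ‖z - (a m - d * ((m : ℂ) + 1))‖ / (‖z - a m‖ * (‖d‖ * ((m : ℝ) + 1)))
      ≤ (ρ + B) / ((‖d‖ * ((m : ℝ) + 1) / 2) * (‖d‖ * ((m : ℝ) + 1))) := by
        gcongr; exact (norm_sub_le _ _).trans (add_le_add hz (hB m))
    _ = _ := by field_simp; ring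

theorem eventually_le_norm_mul (hd : d ≠ 0) (x : ℝ) :
    ∃ M : ℕ, ∀ m ≥ M, x ≤ ‖d‖ * ((m : ℝ) + 1) := by
  obtain ⟨M, hM⟩ := exists_nat_ge (x / ‖d‖)
  refine ⟨M, fun m hm => ?_⟩
  have hd' : 0 < ‖d‖ := norm_pos_iff.2 hd
  rw [div_le_iff₀ hd'] at hM
  have : (M : ℝ) ≤ m := by exact_mod_cast hm
  nlinarith

theorem summable_branchTerm (hd : d ≠ 0) (hB : ∀ m : ℕ, ‖a m - d * ((m : ℂ) + 1)‖ ≤ B) (z : ℂ) :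
    Summable fun m => branchTerm a d m z := by
  obtain ⟨M, hM⟩ := eventually_le_norm_mul hd (2 * (B + (‖z‖ + 1)))
  refine Summable.of_norm_bounded_eventually_nat
    ((summable_natCast_add_one_rpow_neg one_lt_two).mul_left _)
    (eventually_atTop.2 ⟨M, fun m hm => norm_branchTerm_le hd hB (by positivity) (hM m hm) ?_⟩)
  linarith

theorem summable_norm_inv_sq (hd : d ≠ 0) (hB : ∀ m : ℕ, ‖a m - d * ((m : ℂ) + 1)‖ ≤ B) :
    Summable fun m => (‖a m‖ ^ 2)⁻¹ := by
  obtain ⟨M, hM⟩ := eventually_le_norm_mul hd (2 * (B + 0))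
  have hd' : 0 < ‖d‖ := norm_pos_iff.2 hd
  refine Summable.of_norm_bounded_eventually_nat
    ((summable_natCast_add_one_rpow_neg one_lt_two).mul_left (4 / ‖d‖ ^ 2))
    (eventually_atTop.2 ⟨M, fun m hm => ?_⟩)
  have h := le_norm_sub_of_bound hB (hM m hm) (z := 0) (by simp)
  rw [zero_sub, norm_neg] at h
  have hm1 : (0 : ℝ) < (m : ℝ) + 1 := by positivity
  rw [norm_inv, norm_pow, norm_norm, Real.rpow_neg hm1.le, Real.rpow_two]
  calc (‖a m‖ ^ 2)⁻¹ ≤ ((‖d‖ * ((m : ℝ) + 1) / 2) ^ 2)⁻¹ := by gcongr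
    _ = _ := by field_simp; ring

theorem branchTerm_eq_add (a : ℕ → ℂ) (d : ℂ) (m : ℕ) (z₀ : ℂ) :
    ∃ g : ℂ → ℂ, AnalyticAt ℂ g z₀ ∧
      ∀ z, branchTerm a d m z = g z + (if a m = z₀ then 1 else 0) * (z - z₀)⁻¹ := by
  by_cases h : a m = z₀
  · refine ⟨fun _ => (d * ((m : ℂ) + 1))⁻¹, analyticAt_const, fun z => ?_⟩
    simp [branchTerm, h, add_comm]
  · refine ⟨branchTerm a d m, ?_, fun z => by simp [h]⟩
    unfold branchTerm
    exact ((analyticAt_id.sub analyticAt_const).inv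
      (sub_ne_zero.2 (Ne.symm h))).add analyticAt_const

open Classical in
/-- Local structure of the Mittag-Leffler sum of a branch: its only singularities are simple poles
of residue `1` at the points of the branch. -/
theorem branchSum_eq_add (hd : d ≠ 0) (hB : ∀ m : ℕ, ‖a m - d * ((m : ℂ) + 1)‖ ≤ B)
    (ha : Function.Injective a) (z₀ : ℂ) :
    ∃ g : ℂ → ℂ, AnalyticAt ℂ g z₀ ∧
      ∀ᶠ z in 𝓝 z₀, branchSum a d z
        = g z + (if ∃ m, a m = z₀ then 1 else 0) * (z - z₀)⁻¹ := by
  set ρ := ‖z₀‖ + 1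
  have hρ : 0 < ρ := by positivity
  have hd' : 0 < ‖d‖ := norm_pos_iff.2 hd
  obtain ⟨M, hM⟩ := eventually_le_norm_mul hd (2 * (B + ρ))
  have hM' : ∀ m : ℕ, 2 * (B + ρ) ≤ ‖d‖ * (((m + M : ℕ) : ℝ) + 1) := fun m => hM _ (by omega)
  have hne : ∀ m ≥ M, ∀ z, ‖z‖ ≤ ρ → z - a m ≠ 0 := fun m hm z hz =>
    norm_pos_iff.1 (lt_of_lt_of_le (by positivity) (le_norm_sub_of_bound hB (hM m hm) hz))
  have hz₀ : z₀ ∈ Metric.ball (0 : ℂ) ρ := by simp [ρ]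
  choose g hg hgt using fun m => branchTerm_eq_add a d m z₀
  have htail : DifferentiableOn ℂ (fun z => ∑' m, branchTerm a d (m + M) z)
      (Metric.ball 0 ρ) := by
    refine Complex.differentiableOn_tsum_of_summable_norm
      (((summable_nat_add_iff M).2 (summable_natCast_add_one_rpow_neg one_lt_two)).mul_left
        (2 * (B + ρ) / ‖d‖ ^ 2)) (fun m => ?_) Metric.isOpen_ball (fun m z hz => ?_)
    · intro z hz
      have hz' : ‖z‖ ≤ ρ := by simpa using (Metric.mem_ball.1 hz).le
      unfold branchTerm
      have h : DifferentiableAt ℂ (fun w => w - a (m + M)) z := by fun_prop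
      exact ((h.inv (hne (m + M) (by omega) z hz')).add_const _).differentiableWithinAt
    · exact norm_branchTerm_le hd hB hρ (hM' m) (by simpa using (Metric.mem_ball.1 hz).le)
  refine ⟨fun z => ∑ m ∈ Finset.range M, g m z + ∑' m, branchTerm a d (m + M) z, ?_, ?_⟩
  · exact (Finset.analyticAt_fun_sum _ fun m _ => hg m).add
      (htail.analyticAt (Metric.isOpen_ball.mem_nhds hz₀))
  · refine Eventually.of_forall fun z => ?_
    rw [branchSum, ← (summable_branchTerm hd hB z).sum_add_tsum_nat_add M]
    -- Beyond `M` no point of the branch lies in the ball, and by injectivity at most one earlier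
    -- point equals `z₀`.
    have hres : (∑ m ∈ Finset.range M, if a m = z₀ then (1 : ℂ) else 0)
        = if ∃ m, a m = z₀ then 1 else 0 := by
      split_ifs with h
      · obtain ⟨m₀, hm₀⟩ := h
        have hm₀M : m₀ < M := by
          by_contra hlt
          exact hne m₀ (by omega) z₀ (by simp [ρ]) (by simp [hm₀])
        rw [Finset.sum_eq_single_of_mem m₀ (Finset.mem_range.2 hm₀M)]
        · simp [hm₀]
        · intro m _ hm
          rw [if_neg]
          intro h
          exact hm (ha (h.trans hm₀.symm))
      · push Not at h
        exact Finset.sum_eq_zero fun m _ => if_neg (h m)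
    rw [Finset.sum_congr rfl fun m _ => hgt m z, Finset.sum_add_distrib, ← Finset.sum_mul, hres]
    ring

end Estimates

/-! ### Comparison with the exact progression away from its direction -/

/-- Both sides are homogeneous in `(r, x)`, so it suffices to take `r + x = 1` and minimise over the
compact set `Γ × [0, 1]`. A zero minimum would put `u` and `d` on the same ray. -/
theorem exists_pos_le_norm_sub {Γ : Set ℂ} (hΓ : IsCompact Γ) {d : ℂ} (hd : d ≠ 0)
    (hu : ∀ u ∈ Γ, ‖u‖ = 1) (harg : ∀ u ∈ Γ, u.arg ≠ d.arg) :
    ∃ c : ℝ, 0 < c ∧ ∀ u ∈ Γ, ∀ r x : ℝ, 0 ≤ r → 0 ≤ x → c * (r + x) ≤ ‖r * u - d * x‖ := by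
  rcases Γ.eq_empty_or_nonempty with rfl | hne
  · exact ⟨1, one_pos, by simp⟩
  have hK : IsCompact (Γ ×ˢ Set.Icc (0 : ℝ) 1) := hΓ.prod isCompact_Icc
  have hcont : Continuous fun p : ℂ × ℝ => ‖((1 - p.2 : ℝ) : ℂ) * p.1 - d * (p.2 : ℝ)‖ := by
    fun_prop
  obtain ⟨p, hp, hmin⟩ := hK.exists_isMinOn (hne.prod ⟨0, by simp⟩) hcont.continuousOn
  obtain ⟨hpu, hp0, hp1⟩ := hp
  refine ⟨‖((1 - p.2 : ℝ) : ℂ) * p.1 - d * (p.2 : ℝ)‖, ?_, fun u hu' r x hr hx => ?_⟩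
  · rw [norm_pos_iff, sub_ne_zero]
    intro h
    have hp1ne : p.1 ≠ 0 := norm_pos_iff.1 (by rw [hu _ hpu]; exact one_pos)
    rcases hp0.eq_or_lt with h0 | h0
    · simp [← h0, hp1ne] at h
    rcases hp1.eq_or_lt with h1 | h1
    · exact hd (by simpa [h1] using h.symm)
    apply harg _ hpu
    have h2 := congrArg Complex.arg h
    rwa [Complex.arg_real_mul _ (by linarith), mul_comm, Complex.arg_real_mul _ h0] at h2
  · rcases (add_nonneg hr hx).eq_or_lt with h0 | h0
    · rw [← h0]; simp
    have h1 := hmin (show (u, x / (r + x)) ∈ Γ ×ˢ Set.Icc (0 : ℝ) 1 from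
      ⟨hu', by positivity, (div_le_one h0).2 (by linarith)⟩)
    have h1' : ‖((1 - p.2 : ℝ) : ℂ) * p.1 - d * (p.2 : ℝ)‖
        ≤ ‖((1 - x / (r + x) : ℝ) : ℂ) * u - d * (x / (r + x) : ℝ)‖ := h1
    have hne : ((r : ℂ) + x) ≠ 0 := by exact_mod_cast h0.ne'
    calc _ ≤ ‖((1 - x / (r + x) : ℝ) : ℂ) * u - d * (x / (r + x) : ℝ)‖ * (r + x) := by gcongr
      _ = ‖(((1 - x / (r + x) : ℝ) : ℂ) * u - d * (x / (r + x) : ℝ)) * ((r + x : ℝ) : ℂ)‖ := by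
        rw [norm_mul, Complex.norm_of_nonneg h0.le]
      _ = ‖r * u - d * x‖ := by
        congr 1
        push_cast
        field_simp
        ring

/-- Split the exponent `2` as `p + (2 - p)`: the first share becomes decay in `X`, the second pays
for summability in `n`. -/
theorem rpow_neg_mul_inv_sq_le {X n ε p : ℝ} (hX : 0 < X) (hn : 0 < n) (hp0 : 0 ≤ p) (hp2 : p ≤ 2) :
    n ^ (-ε) * ((X + n) ^ 2)⁻¹ ≤ X ^ (-p) * n ^ (-(2 - p + ε)) := by
  have hXn : 0 < X + n := by positivity
  have h1 : ((X + n) ^ 2)⁻¹ = (X + n) ^ (-p) * (X + n) ^ (-(2 - p)) := by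
    rw [← Real.rpow_add hXn, ← Real.rpow_two, ← Real.rpow_neg hXn.le]
    ring_nf
  have h2 : (X + n) ^ (-p) ≤ X ^ (-p) :=
    Real.rpow_le_rpow_of_nonpos hX (by linarith) (by linarith)
  have h3 : (X + n) ^ (-(2 - p)) ≤ n ^ (-(2 - p)) :=
    Real.rpow_le_rpow_of_nonpos hn (by linarith) (by linarith)
  have h4 : n ^ (-(2 - p + ε)) = n ^ (-ε) * n ^ (-(2 - p)) := by
    rw [← Real.rpow_add hn]; ring_nf
  calc n ^ (-ε) * ((X + n) ^ 2)⁻¹ ≤ n ^ (-ε) * (X ^ (-p) * n ^ (-(2 - p))) := by rw [h1]; gcongr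
    _ = _ := by rw [h4]; ring

theorem summable_and_norm_tsum_le {u : ℕ → ℂ} {C X ε p : ℝ} (hC : 0 ≤ C) (hX : 0 < X)
    (hp0 : 0 ≤ p) (hp2 : p ≤ 2) (hs : 1 < 2 - p + ε)
    (hu : ∀ m : ℕ, ‖u m‖ ≤ C * (((m : ℝ) + 1) ^ (-ε) * ((X + ((m : ℝ) + 1)) ^ 2)⁻¹)) :
    Summable u ∧
      ‖∑' m, u m‖ ≤ C * (∑' m : ℕ, ((m : ℝ) + 1) ^ (-(2 - p + ε))) * X ^ (-p) := by
  have hle : ∀ m : ℕ, ‖u m‖ ≤ C * X ^ (-p) * ((m : ℝ) + 1) ^ (-(2 - p + ε)) := fun m => by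
    rw [mul_assoc]
    exact (hu m).trans (mul_le_mul_of_nonneg_left
      (rpow_neg_mul_inv_sq_le hX (by positivity) hp0 hp2) hC)
  have hsum := (summable_natCast_add_one_rpow_neg hs).mul_left (C * X ^ (-p))
  refine ⟨Summable.of_norm_bounded hsum hle, (tsum_of_norm_bounded hsum.hasSum hle).trans ?_⟩
  rw [tsum_mul_left]
  exact le_of_eq (by ring)

/-- The point `z` keeps a relative distance at least `c` from the ray in direction `d`. -/
def AwayFromRay (c : ℝ) (d z : ℂ) : Prop := ∀ x : ℝ, 0 ≤ x → c * (‖z‖ + x) ≤ ‖z - d * x‖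

namespace AwayFromRay

variable {c : ℝ} {d z : ℂ}

theorem le_succ (h : AwayFromRay c d z) (m : ℕ) :
    c * (‖z‖ + ((m : ℝ) + 1)) ≤ ‖z - d * ((m : ℂ) + 1)‖ := by
  have := h ((m : ℝ) + 1) (by positivity)
  simpa using this

theorem le_natCast (h : AwayFromRay c d z) (hc : 0 < c) (hz : 1 ≤ ‖z‖) (m : ℕ) :
    c / 2 * (‖z‖ + ((m : ℝ) + 1)) ≤ ‖z - d * (m : ℂ)‖ := by
  have h1 := h (m : ℝ) (by positivity)
  have hm : (0 : ℝ) ≤ m := Nat.cast_nonneg m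
  have h2 : c / 2 * (‖z‖ + ((m : ℝ) + 1)) ≤ c * (‖z‖ + m) := by nlinarith
  exact h2.trans (by simpa using h1)

/-- Source of the term `-ξ / z`: to first order, shifting the progression by `ξ` changes the `m`-th
term by `ξ` times this difference, and the differences telescope exactly. -/
theorem hasSum_telescope (h : AwayFromRay c d z) (hc : 0 < c) (hz : 1 ≤ ‖z‖) :
    HasSum (fun m : ℕ => (z - d * ((m : ℂ) + 1))⁻¹ - (z - d * (m : ℂ))⁻¹) (-z⁻¹) := by
  have hX : 0 < ‖z‖ := by linarith
  have hb : ∀ m : ℕ, ‖(z - d * ((m : ℂ) + 1))⁻¹ - (z - d * (m : ℂ))⁻¹‖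
      ≤ ‖d‖ / (c / 2) ^ 2 * (((m : ℝ) + 1) ^ (-0 : ℝ) * ((‖z‖ + ((m : ℝ) + 1)) ^ 2)⁻¹) := fun m => by
    have h1 := h.le_succ m
    have h0 := h.le_natCast hc hz m
    have hY : 0 < ‖z‖ + ((m : ℝ) + 1) := by positivity
    have h1' : c / 2 * (‖z‖ + ((m : ℝ) + 1)) ≤ ‖z - d * ((m : ℂ) + 1)‖ := by nlinarith
    have n1 : z - d * ((m : ℂ) + 1) ≠ 0 := norm_pos_iff.1 (lt_of_lt_of_le (by positivity) h1')
    have n0 : z - d * (m : ℂ) ≠ 0 := norm_pos_iff.1 (lt_of_lt_of_le (by positivity) h0)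
    have e : (z - d * ((m : ℂ) + 1))⁻¹ - (z - d * (m : ℂ))⁻¹
        = d / ((z - d * ((m : ℂ) + 1)) * (z - d * (m : ℂ))) := by
      field_simp; ring
    rw [e, norm_div, norm_mul]
    calc ‖d‖ / (‖z - d * ((m : ℂ) + 1)‖ * ‖z - d * (m : ℂ)‖)
        ≤ ‖d‖ / ((c / 2 * (‖z‖ + ((m : ℝ) + 1))) * (c / 2 * (‖z‖ + ((m : ℝ) + 1)))) := by gcongr
      _ = _ := by rw [neg_zero, Real.rpow_zero]; field_simp
  have hs := (summable_and_norm_tsum_le (p := 1 / 2) (by positivity) hX (by norm_num) (by norm_num)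
    (by norm_num) hb).1
  have ht := hs.hasSum.tendsto_sum_nat
  have ht' : Tendsto (fun n : ℕ => ∑ m ∈ Finset.range n,
      ((z - d * ((m : ℂ) + 1))⁻¹ - (z - d * (m : ℂ))⁻¹)) atTop (𝓝 (-z⁻¹)) := by
    have e : ∀ n : ℕ, ∑ m ∈ Finset.range n,
        ((z - d * ((m : ℂ) + 1))⁻¹ - (z - d * (m : ℂ))⁻¹) = (z - d * (n : ℂ))⁻¹ - z⁻¹ := fun n => by
      have := Finset.sum_range_sub (fun m : ℕ => (z - d * (m : ℂ))⁻¹) n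
      simpa using this
    simp_rw [e]
    have : Tendsto (fun n : ℕ => (z - d * (n : ℂ))⁻¹) atTop (𝓝 0) := by
      rw [tendsto_zero_iff_norm_tendsto_zero]
      simp_rw [norm_inv]
      refine Tendsto.inv_tendsto_atTop (tendsto_atTop_mono (fun n => ?_)
        (tendsto_natCast_atTop_atTop.const_mul_atTop hc))
      have := h (n : ℝ) (by positivity)
      have h3 : c * (n : ℝ) ≤ c * (‖z‖ + n) := by gcongr; linarith
      exact h3.trans (by simpa using this)
    simpa using this.sub_const z⁻¹
  rw [← tendsto_nhds_unique ht ht']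
  exact hs.hasSum

end AwayFromRay

/-- Away from its direction, the Mittag-Leffler sum of a branch differs from that of the exact
arithmetic progression by `-ξ / z` up to a smaller power. -/
theorem IsAsymptoticBranch.exists_branchSum_sub_le {a : ℕ → ℂ} {d ξ : ℂ}
    (h : IsAsymptoticBranch a d ξ) {c : ℝ} (hc : 0 < c) :
    ∃ δ C ρ : ℝ, 0 < δ ∧ 0 ≤ C ∧ 1 ≤ ρ ∧ ∀ z, ρ ≤ ‖z‖ → AwayFromRay c d z → (∀ m, a m ≠ z) ∧
      ‖branchSum a d z - branchSum (fun m => d * ((m : ℂ) + 1)) d z + ξ / z‖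
        ≤ C * ‖z‖ ^ (-(1 + δ)) := by
  have hd := h.1
  obtain ⟨ε, B₁, hε, hε1, hB₁, hb₁⟩ := h.exists_rpow_bound
  obtain ⟨B, hB, hb⟩ := h.exists_bound
  obtain ⟨B', -, hb'⟩ := (isAsymptoticBranch_linear hd).exists_bound
  set C := B₁ / (c / 2) ^ 2 + ‖d * ξ‖ * (B + ‖d‖) / (c / 2) ^ 3 with hC
  have hC0 : 0 ≤ C := by positivity
  -- With `p = 1 + ε / 2` the exponent left for the sum is `1 + ε / 2 > 1`. The radius `2 * B / c`
  -- makes the displacement `B` at most half of the separation `c * ‖z‖`.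
  refine ⟨ε / 2, C * ∑' m : ℕ, ((m : ℝ) + 1) ^ (-(2 - (1 + ε / 2) + ε)), max 1 (2 * B / c),
    by positivity, mul_nonneg hC0 (tsum_nonneg fun m => by positivity), le_max_left _ _,
    fun z hz haw => ?_⟩
  have hz1 : 1 ≤ ‖z‖ := (le_max_left _ _).trans hz
  have hzB : 2 * B ≤ c * ‖z‖ := by
    have := (le_max_right _ _).trans hz
    rwa [div_le_iff₀ hc, mul_comm ‖z‖] at this
  have hX : 0 < ‖z‖ := by linarith
  have hA : ∀ m : ℕ, c / 2 * (‖z‖ + ((m : ℝ) + 1)) ≤ ‖z - a m‖ := fun m => by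
    have h1 := haw.le_succ m
    have h2 : ‖z - d * ((m : ℂ) + 1)‖ ≤ ‖z - a m‖ + ‖a m - d * ((m : ℂ) + 1)‖ := by
      calc _ = ‖(z - a m) + (a m - d * ((m : ℂ) + 1))‖ := by ring_nf
        _ ≤ _ := norm_add_le _ _
    have h3 := hb m
    have : (0 : ℝ) < (m : ℝ) + 1 := by positivity
    nlinarith
  have hY : ∀ m : ℕ, 0 < ‖z‖ + ((m : ℝ) + 1) := fun m => by positivity
  have hA0 : ∀ m, z - a m ≠ 0 := fun m =>
    norm_pos_iff.1 (lt_of_lt_of_le (mul_pos (by positivity) (hY m)) (hA m))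
  refine ⟨fun m hm => hA0 m (by rw [hm, sub_self]), ?_⟩
  -- After subtraction of the telescoping term only the branch error `O((m + 1) ^ (-ε))` over a
  -- quadratic denominator and a bounded numerator over a cubic one survive.
  have hu : ∀ m : ℕ, ‖branchTerm a d m z - branchTerm (fun m => d * ((m : ℂ) + 1)) d m z
      - ξ * ((z - d * ((m : ℂ) + 1))⁻¹ - (z - d * (m : ℂ))⁻¹)‖
      ≤ C * (((m : ℝ) + 1) ^ (-ε) * ((‖z‖ + ((m : ℝ) + 1)) ^ 2)⁻¹) := fun m => by
    have hY := hY m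
    have hA := hA m
    have n2 := hA0 m
    have h1 : c / 2 * (‖z‖ + ((m : ℝ) + 1)) ≤ ‖z - d * ((m : ℂ) + 1)‖ := by
      nlinarith [haw.le_succ m]
    have h0 := haw.le_natCast hc hz1 m
    have n1 : z - d * ((m : ℂ) + 1) ≠ 0 := norm_pos_iff.1 (lt_of_lt_of_le (by positivity) h1)
    have n0 : z - d * (m : ℂ) ≠ 0 := norm_pos_iff.1 (lt_of_lt_of_le (by positivity) h0)
    have e : branchTerm a d m z - branchTerm (fun m => d * ((m : ℂ) + 1)) d m z
        - ξ * ((z - d * ((m : ℂ) + 1))⁻¹ - (z - d * (m : ℂ))⁻¹)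
        = (a m - d * ((m : ℂ) + 1 + ξ)) / ((z - a m) * (z - d * ((m : ℂ) + 1)))
          + d * ξ * (a m - d * (m : ℂ))
            / ((z - a m) * (z - d * ((m : ℂ) + 1)) * (z - d * (m : ℂ))) := by
      simp only [branchTerm]
      field_simp
      ring
    have h2 : ‖a m - d * (m : ℂ)‖ ≤ B + ‖d‖ := by
      calc _ = ‖(a m - d * ((m : ℂ) + 1)) + d‖ := by ring_nf
        _ ≤ _ := (norm_add_le _ _).trans (by gcongr; exact hb m)
    have hm1 : (1 : ℝ) ≤ (m : ℝ) + 1 := by linarith [(Nat.cast_nonneg m : (0 : ℝ) ≤ m)]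
    have h3 : (‖z‖ + ((m : ℝ) + 1))⁻¹ ≤ ((m : ℝ) + 1) ^ (-ε) := by
      calc (‖z‖ + ((m : ℝ) + 1))⁻¹ ≤ ((m : ℝ) + 1)⁻¹ := inv_anti₀ (by positivity) (by linarith)
        _ = ((m : ℝ) + 1) ^ (-1 : ℝ) := (Real.rpow_neg_one _).symm
        _ ≤ _ := by gcongr
    rw [e]
    refine (norm_add_le _ _).trans ?_
    rw [norm_div, norm_div, norm_mul (d * ξ), norm_mul, norm_mul, norm_mul (_ * _) (z - d * m),
      norm_mul (z - a m)]
    set Y := ‖z‖ + ((m : ℝ) + 1) with hYdef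
    calc _ ≤ B₁ * ((m : ℝ) + 1) ^ (-ε) / ((c / 2 * Y) * (c / 2 * Y))
          + ‖d‖ * ‖ξ‖ * (B + ‖d‖) / ((c / 2 * Y) * (c / 2 * Y) * (c / 2 * Y)) := by
          gcongr
          · exact hb₁ m
      _ = B₁ / (c / 2) ^ 2 * (((m : ℝ) + 1) ^ (-ε) * (Y ^ 2)⁻¹)
          + ‖d * ξ‖ * (B + ‖d‖) / (c / 2) ^ 3 * (Y⁻¹ * (Y ^ 2)⁻¹) := by
          rw [norm_mul]
          field_simp
      _ ≤ B₁ / (c / 2) ^ 2 * (((m : ℝ) + 1) ^ (-ε) * (Y ^ 2)⁻¹)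
          + ‖d * ξ‖ * (B + ‖d‖) / (c / 2) ^ 3 * (((m : ℝ) + 1) ^ (-ε) * (Y ^ 2)⁻¹) := by
          gcongr
      _ = _ := by rw [hC]; ring
  have hsum := (((summable_branchTerm hd hb z).hasSum.sub
    (summable_branchTerm hd hb' z).hasSum).sub ((haw.hasSum_telescope hc hz1).mul_left ξ)).tsum_eq
  have hle := (summable_and_norm_tsum_le (p := 1 + ε / 2) hC0 hX (by linarith) (by linarith)
    (by linarith) hu).2
  rw [hsum] at hle
  have e : branchSum a d z - branchSum (fun m => d * ((m : ℂ) + 1)) d z + ξ / z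
    = branchSum a d z - branchSum (fun m => d * ((m : ℂ) + 1)) d z - ξ * -z⁻¹ := by
      rw [div_eq_mul_inv]; ring
  rw [e]
  exact hle

/-! ### Logarithmic asymptotics of the exact progression -/

/-- Mean value inequality for `log (y + t) - t / (y + 1)` on `[0, 1]`, whose derivative is `(1 - t)
/ ((y + t) (y + 1))`. -/
theorem norm_log_add_one_sub_log_sub_inv_le {y : ℂ} {μ : ℝ} (hμ : 0 < μ)
    (hs : ∀ t ∈ Set.Icc (0 : ℝ) 1, y + t ∈ Complex.slitPlane)
    (hb : ∀ t ∈ Set.Icc (0 : ℝ) 1, μ ≤ ‖y + t‖) :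
    ‖Complex.log (y + 1) - Complex.log y - (y + 1)⁻¹‖ ≤ (μ ^ 2)⁻¹ := by
  have hne : ∀ t ∈ Set.Icc (0 : ℝ) 1, y + t ≠ 0 := fun t ht =>
    norm_pos_iff.1 (hμ.trans_le (hb t ht))
  have hb1 := hb 1 (by simp)
  have hne1 := hne 1 (by simp)
  rw [Complex.ofReal_one] at hb1 hne1
  have key := norm_image_sub_le_of_norm_deriv_le_segment_01' (C := (μ ^ 2)⁻¹)
    (f := fun t : ℝ => Complex.log (y + t) - t * (y + 1)⁻¹)
    (f' := fun t : ℝ => (y + t)⁻¹ - (y + 1)⁻¹) (fun t ht => ?_) (fun t ht => ?_)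
  · simp only [Complex.ofReal_one, Complex.ofReal_zero, add_zero, zero_mul, sub_zero, one_mul]
      at key
    rwa [sub_right_comm]
  · have h1 : HasDerivAt (fun t : ℝ => y + (t : ℂ)) 1 t :=
      (Complex.ofRealCLM.hasDerivAt (x := t)).const_add y
    have h2 : HasDerivAt (fun t : ℝ => (t : ℂ) * (y + 1)⁻¹) (1 * (y + 1)⁻¹) t :=
      (Complex.ofRealCLM.hasDerivAt (x := t)).mul_const _
    have h3 := (h1.clog_real (hs t ht)).sub h2
    rw [one_div, one_mul] at h3
    exact h3.hasDerivWithinAt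
  · have ht' : t ∈ Set.Icc (0 : ℝ) 1 := ⟨ht.1, ht.2.le⟩
    have hnet := hne t ht'
    have e : (y + t)⁻¹ - (y + 1)⁻¹ = ((1 - t : ℝ) : ℂ) / ((y + t) * (y + 1)) := by
      push_cast
      field_simp
      ring
    rw [e, norm_div, norm_mul, Complex.norm_of_nonneg (by linarith [ht.2])]
    calc (1 - t) / (‖y + t‖ * ‖y + 1‖) ≤ 1 / (μ * μ) := by
          gcongr
          · linarith [ht.1]
          · exact hb t ht'
      _ = _ := by rw [one_div, sq]

/-- If `x - z / d` were a nonpositive real, then `z / d` would be a nonnegative real and `z` would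
lie on the ray. -/
theorem AwayFromRay.sub_mem_slitPlane {c : ℝ} {d z : ℂ} (h : AwayFromRay c d z) (hc : 0 < c)
    (hz : z ≠ 0) (hd : d ≠ 0) {x : ℝ} (hx : 0 ≤ x) : (x : ℂ) - z / d ∈ Complex.slitPlane := by
  by_contra hns
  rw [Complex.mem_slitPlane_iff, not_or, not_lt, not_not] at hns
  obtain ⟨hre, him⟩ := hns
  simp only [Complex.sub_re, Complex.ofReal_re, Complex.sub_im, Complex.ofReal_im] at hre him
  have h1 : z / d = ((z / d).re : ℝ) := by
    apply Complex.ext <;> simp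
    linarith
  have h2 := h (z / d).re (by linarith)
  rw [← h1, mul_div_cancel₀ _ hd, sub_self, norm_zero] at h2
  have : 0 < ‖z‖ := norm_pos_iff.2 hz
  nlinarith

theorem tendsto_log_natCast_sub (w : ℂ) :
    Tendsto (fun n : ℕ => Complex.log (n - w) - Real.log n) atTop (𝓝 0) := by
  have h1 : Tendsto (fun n : ℕ => 1 - w * (n : ℂ)⁻¹) atTop (𝓝 (1 - w * 0)) := by
    refine tendsto_const_nhds.sub (tendsto_const_nhds.mul ?_)
    exact tendsto_inv_atTop_nhds_zero_nat
  have h2 := (h1.clog (by simp))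
  simp only [mul_zero, sub_zero, Complex.log_one] at h2
  refine h2.congr' ?_
  filter_upwards [eventually_gt_atTop 0, h1.eventually_ne (by simp : (1 - w * 0 : ℂ) ≠ 0)]
    with n hn hne
  have hn' : (0 : ℝ) < n := by exact_mod_cast hn
  have hnc : (n : ℂ) ≠ 0 := by exact_mod_cast hn.ne'
  have e : (n : ℂ) - w = ((n : ℝ) : ℂ) * (1 - w * (n : ℂ)⁻¹) := by
    push_cast
    field_simp
  rw [e, Complex.log_ofReal_mul hn' hne]
  push_cast
  ring

/-- Asymptotics of the Mittag-Leffler sum of an arithmetic progression away from its direction. -/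
theorem exists_branchSum_linear_le {d : ℂ} (hd : d ≠ 0) {c : ℝ} (hc : 0 < c) :
    ∃ C : ℝ, 0 ≤ C ∧ ∀ z, 1 ≤ ‖z‖ → AwayFromRay c d z →
      ‖branchSum (fun m => d * ((m : ℂ) + 1)) d z
        - d⁻¹ * (Complex.log (-(z / d)) + Real.eulerMascheroniConstant)‖
          ≤ C * ‖z‖ ^ (-(1 / 2) : ℝ) := by
  have hd' : 0 < ‖d‖ := norm_pos_iff.2 hd
  set K := (c / (2 * ‖d‖)) with hK
  have hK0 : 0 < K := by positivity
  refine ⟨‖d⁻¹‖ * ((K ^ 2)⁻¹ * ∑' m : ℕ, ((m : ℝ) + 1) ^ (-(2 - 1 / 2 + 0) : ℝ)),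
    mul_nonneg (norm_nonneg _) (mul_nonneg (by positivity) (tsum_nonneg fun m => by positivity)),
    fun z hz haw => ?_⟩
  have hX : 0 < ‖z‖ := by linarith
  have hz0 : z ≠ 0 := norm_pos_iff.1 hX
  set w := z / d with hw
  have hzw : z = d * w := by rw [hw]; field_simp
  obtain ⟨B', -, hb'⟩ := (isAsymptoticBranch_linear hd).exists_bound
  set v : ℕ → ℂ := fun m => Complex.log (((m : ℂ) - w) + 1) - Complex.log ((m : ℂ) - w)
    - (((m : ℂ) - w) + 1)⁻¹ with hv
  have hvb : ∀ m : ℕ, ‖v m‖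
      ≤ (K ^ 2)⁻¹ * (((m : ℝ) + 1) ^ (-0 : ℝ) * ((‖z‖ + ((m : ℝ) + 1)) ^ 2)⁻¹) := fun m => by
    have hm : (0 : ℝ) ≤ m := Nat.cast_nonneg m
    have e : ∀ t : ℝ, (m : ℂ) - w + t = ((m + t : ℝ) : ℂ) - w := fun t => by push_cast; ring
    have := norm_log_add_one_sub_log_sub_inv_le (y := (m : ℂ) - w)
      (μ := K * (‖z‖ + ((m : ℝ) + 1))) (by positivity)
      (fun t ht => by rw [e]; exact haw.sub_mem_slitPlane hc hz0 hd (by linarith [ht.1]))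
      (fun t ht => by
        rw [e]
        have h1 := haw (m + t) (by linarith [ht.1])
        have h2 : z - d * ((m + t : ℝ) : ℂ) = -d * (((m + t : ℝ) : ℂ) - w) := by
          rw [hzw]; ring
        rw [h2, norm_mul, norm_neg] at h1
        rw [hK]
        have h3 : c * (‖z‖ + ((m : ℝ) + 1)) / 2 ≤ ‖d‖ * ‖((m + t : ℝ) : ℂ) - w‖ := by
          nlinarith [ht.1]
        rw [div_mul_eq_mul_div, div_le_iff₀ (by positivity)]
        linarith)
    refine this.trans (le_of_eq ?_)
    rw [neg_zero, Real.rpow_zero, one_mul, mul_pow, mul_inv]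
  obtain ⟨hvs, hvn⟩ := summable_and_norm_tsum_le (p := 1 / 2) (by positivity) hX (by norm_num)
    (by norm_num) (by norm_num) hvb
  -- Comparing each reciprocal with a logarithmic increment makes the logarithms telescope. The
  -- counterterms form the harmonic number, which produces Euler's constant.
  have hpart : ∀ n : ℕ, d * ∑ m ∈ Finset.range n, branchTerm (fun m => d * ((m : ℂ) + 1)) d m z
      = ∑ m ∈ Finset.range n, v m + ((((harmonic n : ℚ) : ℝ) - Real.log n : ℝ) : ℂ)
        - (Complex.log (n - w) - Real.log n) + Complex.log (-w) := fun n => by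
    have h1 := Finset.sum_range_sub (fun m : ℕ => Complex.log ((m : ℂ) - w)) n
    have h2 : ∀ m : ℕ, d * branchTerm (fun m => d * ((m : ℂ) + 1)) d m z
        = v m + ((m : ℂ) + 1)⁻¹
          - (Complex.log (((m + 1 : ℕ) : ℂ) - w) - Complex.log ((m : ℂ) - w)) := fun m => by
      have e1 : ((m + 1 : ℕ) : ℂ) - w = (m : ℂ) - w + 1 := by push_cast; ring
      have e2 : z - d * ((m : ℂ) + 1) = -(d * ((m : ℂ) - w + 1)) := by rw [hzw]; ring
      rw [e1, hv, branchTerm, e2]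
      rw [mul_add, inv_neg, mul_inv, mul_neg, mul_inv_cancel_left₀ hd, mul_inv,
        mul_inv_cancel_left₀ hd]
      ring
    rw [Finset.mul_sum, Finset.sum_congr rfl fun m _ => h2 m, Finset.sum_sub_distrib, h1,
      Finset.sum_add_distrib, harmonic]
    push_cast
    simp only [zero_sub]
    ring
  have hL := ((summable_branchTerm hd hb' z).hasSum.tendsto_sum_nat).const_mul d
  have hγ : Tendsto (fun n : ℕ => ((((harmonic n : ℚ) : ℝ) - Real.log n : ℝ) : ℂ)) atTop
      (𝓝 (Real.eulerMascheroniConstant : ℂ)) :=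
    (Complex.continuous_ofReal.tendsto _).comp Real.tendsto_harmonic_sub_log
  have hR := ((hvs.hasSum.tendsto_sum_nat.add hγ).sub (tendsto_log_natCast_sub w)).add_const
    (Complex.log (-w))
  simp_rw [hpart] at hL
  have heq := tendsto_nhds_unique hL hR
  have hfin : branchSum (fun m => d * ((m : ℂ) + 1)) d z
      - d⁻¹ * (Complex.log (-w) + Real.eulerMascheroniConstant) = d⁻¹ * ∑' m, v m := by
    have : branchSum (fun m => d * ((m : ℂ) + 1)) d z = d⁻¹ * (d *
        ∑' m, branchTerm (fun m => d * ((m : ℂ) + 1)) d m z) := by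
      rw [inv_mul_cancel_left₀ hd, branchSum]
    rw [this, heq]
    ring
  rw [hfin, norm_mul, mul_assoc]
  gcongr

/-! ### Circle integrals of the Mittag-Leffler sums -/

section CircleIntegrals

theorem circleIntegral_inv_pow_of_two_le {k : ℕ} (hk : 2 ≤ k) (R : ℝ) :
    (∮ z in C(0, R), (z ^ k)⁻¹) = 0 := by
  have h := circleIntegral.integral_sub_zpow_of_ne (n := -(k : ℤ)) (by omega) 0 0 R
  simpa using h

theorem continuousOn_inv_pow_mul_inv_sub {a : ℂ} {R : ℝ} (hR : 0 < R) (ha : ‖a‖ ≠ R) (k : ℕ) :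
    ContinuousOn (fun z : ℂ => (z ^ k)⁻¹ * (z - a)⁻¹) (Metric.sphere 0 R) := by
  have h0 : ∀ z ∈ Metric.sphere (0 : ℂ) R, ‖z‖ = R := fun z hz => by simpa using hz
  refine ContinuousOn.mul (ContinuousOn.inv₀ (by fun_prop) fun z hz => ?_)
    (ContinuousOn.inv₀ (by fun_prop) fun z hz => ?_)
  · exact pow_ne_zero _ (norm_pos_iff.1 (by rw [h0 z hz]; exact hR))
  · exact sub_ne_zero.2 fun h => ha (by rw [← h, h0 z hz])

/-- Induction on `1 / (z ^ (k + 1) (z - a)) = a⁻¹ (1 / (z ^ k (z - a)) - 1 / z ^ (k + 1))`; only `k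
= 0` picks up the integral `2πi` of `1 / z`. -/
theorem circleIntegral_inv_pow_mul_inv_sub {a : ℂ} {R : ℝ} (hR : 0 < R) (ha : ‖a‖ ≠ R)
    (ha0 : a ≠ 0) (k : ℕ) :
    (∮ z in C(0, R), (z ^ (k + 1))⁻¹ * (z - a)⁻¹)
      = ((∮ z in C(0, R), (z - a)⁻¹) - 2 * Real.pi * Complex.I) / a ^ (k + 1) := by
  have h0 : ∀ z ∈ Metric.sphere (0 : ℂ) R, z ≠ 0 := fun z hz =>
    norm_pos_iff.1 (by rw [show ‖z‖ = R by simpa using hz]; exact hR)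
  have hsub : ∀ z ∈ Metric.sphere (0 : ℂ) R, z - a ≠ 0 := fun z hz =>
    sub_ne_zero.2 fun h => ha (by rw [← h]; simpa using hz)
  have hrec : ∀ k : ℕ, (∮ z in C(0, R), (z ^ (k + 1))⁻¹ * (z - a)⁻¹)
      = a⁻¹ * ((∮ z in C(0, R), (z ^ k)⁻¹ * (z - a)⁻¹) - ∮ z in C(0, R), (z ^ (k + 1))⁻¹) := by
    intro k
    rw [← circleIntegral.integral_sub, ← circleIntegral.integral_const_mul]
    · refine circleIntegral.integral_congr hR.le fun z hz => ?_
      have := h0 z hz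
      have := hsub z hz
      field_simp
      ring
    · exact (continuousOn_inv_pow_mul_inv_sub hR ha k).circleIntegrable hR.le
    · refine ContinuousOn.circleIntegrable hR.le ?_
      exact ContinuousOn.inv₀ (by fun_prop) fun z hz => pow_ne_zero _ (h0 z hz)
  induction k with
  | zero =>
    rw [hrec 0]
    have h1 := circleIntegral.integral_sub_inv_of_mem_ball (c := 0) (w := 0) (R := R) (by simpa)
    simp only [sub_zero] at h1
    simp only [pow_zero, inv_one, one_mul, zero_add, pow_one]
    rw [h1]
    field_simp
  | succ k ih =>
    rw [hrec (k + 1), ih, circleIntegral_inv_pow_of_two_le (by omega)]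
    field_simp
    ring

/-- For `a` inside the circle the residues cancel; for `a` outside, the residue at `0` has size `‖a‖
^ (-(q + 2))`. The bound does not degrade as `‖a‖` approaches `R`, so no gap between the circles and
the branch points is required. -/
theorem norm_circleIntegral_inv_pow_mul_inv_sub_le {a : ℂ} {R : ℝ} (hR : 0 < R) (ha : ‖a‖ ≠ R)
    (q : ℕ) :
    ‖∮ z in C(0, R), (z ^ (q + 2))⁻¹ * (z - a)⁻¹‖
      ≤ 2 * Real.pi * (R ^ q)⁻¹ * (‖a‖ ^ 2)⁻¹ := by
  have hπ := Real.pi_pos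
  rcases ha.lt_or_gt with h | h
  · have hz : (∮ z in C(0, R), (z ^ (q + 2))⁻¹ * (z - a)⁻¹) = 0 := by
      -- For `a = 0` the claimed bound is `0`, because `0⁻¹ = 0`; the integrand is then a pure power
      -- with zero integral.
      rcases eq_or_ne a 0 with rfl | ha0
      · refine Eq.trans ?_ (circleIntegral_inv_pow_of_two_le (show 2 ≤ q + 3 by omega) R)
        refine circleIntegral.integral_congr (g := fun z : ℂ => (z ^ (q + 3))⁻¹) hR.le
          fun z _ => ?_
        simp only [sub_zero]
        rw [pow_succ z (q + 2), mul_inv]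
      · rw [circleIntegral_inv_pow_mul_inv_sub hR ha ha0,
          circleIntegral.integral_sub_inv_of_mem_ball (by simpa using h)]
        simp
    rw [hz, norm_zero]
    positivity
  · have ha0 : a ≠ 0 := norm_pos_iff.1 (hR.trans h)
    have h1 : (∮ z in C(0, R), (z - a)⁻¹) = 0 := by
      refine Complex.circleIntegral_eq_zero_of_differentiable_on_off_countable hR.le
        Set.countable_empty ?_ fun z hz => ?_
      · refine ContinuousOn.inv₀ (by fun_prop) fun z hz => sub_ne_zero.2 fun hza => ?_
        rw [hza] at hz
        have : ‖a‖ ≤ R := by simpa using hz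
        linarith
      · have hd : DifferentiableAt ℂ (fun w => w - a) z := by fun_prop
        refine hd.inv (sub_ne_zero.2 fun hza => ?_)
        have : ‖z‖ < R := by simpa using hz.1
        rw [hza] at this
        linarith
    rw [circleIntegral_inv_pow_mul_inv_sub hR ha ha0, h1, norm_div, norm_pow, zero_sub, norm_neg,
      norm_mul, norm_mul, Complex.norm_I, Complex.norm_of_nonneg hπ.le, Complex.norm_ofNat, mul_one]
    calc 2 * Real.pi / ‖a‖ ^ (q + 1 + 1) = 2 * Real.pi * (‖a‖ ^ q)⁻¹ * (‖a‖ ^ 2)⁻¹ := by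
          rw [show q + 1 + 1 = q + 2 from rfl, pow_add]
          field_simp
      _ ≤ _ := by gcongr

end CircleIntegrals

section BranchSum

variable {a : ℕ → ℂ} {d : ℂ} {B R : ℝ}

theorem analyticAt_branchSum (hd : d ≠ 0) (hB : ∀ m : ℕ, ‖a m - d * ((m : ℂ) + 1)‖ ≤ B)
    (ha : Function.Injective a) {z₀ : ℂ} (hz : ∀ m, a m ≠ z₀) :
    AnalyticAt ℂ (branchSum a d) z₀ := by
  obtain ⟨g, hg, hge⟩ := branchSum_eq_add hd hB ha z₀
  refine hg.congr ?_
  filter_upwards [hge] with z hz'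
  rw [hz', if_neg (not_exists.2 hz), zero_mul, add_zero]

theorem continuousOn_branchTerm (hne : ∀ m, ‖a m‖ ≠ R) (m : ℕ) :
    ContinuousOn (branchTerm a d m) (Metric.sphere 0 R) := by
  unfold branchTerm
  refine ContinuousOn.add (ContinuousOn.inv₀ (by fun_prop) fun z hz => ?_) continuousOn_const
  exact sub_ne_zero.2 fun h => hne m (by rw [← h]; simpa using hz)

/-- Domination for termwise integration: compactness handles the finitely many early terms,
quadratic decay the rest. -/
theorem exists_summable_bound_on_sphere (hd : d ≠ 0)
    (hB : ∀ m : ℕ, ‖a m - d * ((m : ℂ) + 1)‖ ≤ B) (hR : 0 < R) (hne : ∀ m, ‖a m‖ ≠ R) :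
    ∃ u : ℕ → ℝ, Summable u ∧ ∀ m, ∀ z ∈ Metric.sphere (0 : ℂ) R, ‖branchTerm a d m z‖ ≤ u m := by
  obtain ⟨M, hM⟩ := eventually_le_norm_mul hd (2 * (B + R))
  choose C hC using fun m => (isCompact_sphere (0 : ℂ) R).exists_bound_of_continuousOn
    (continuousOn_branchTerm (d := d) hne m)
  refine ⟨fun m => if m < M then C m else 2 * (B + R) / ‖d‖ ^ 2 * ((m : ℝ) + 1) ^ (-2 : ℝ), ?_, ?_⟩
  · refine (summable_nat_add_iff M).1 ?_
    simp only [add_lt_iff_neg_right, not_lt_zero, if_false]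
    exact (summable_nat_add_iff M).2
      ((summable_natCast_add_one_rpow_neg one_lt_two).mul_left (2 * (B + R) / ‖d‖ ^ 2))
  · intro m z hz
    beta_reduce
    split_ifs with h
    · exact hC m z hz
    · refine norm_branchTerm_le hd hB hR (hM m (not_lt.1 h)) ?_
      exact le_of_eq (by simpa using hz)

theorem norm_circleIntegral_branchSum_le (hd : d ≠ 0)
    (hB : ∀ m : ℕ, ‖a m - d * ((m : ℂ) + 1)‖ ≤ B) (hR : 0 < R) (hne : ∀ m, ‖a m‖ ≠ R) (q : ℕ) :
    ‖∮ z in C(0, R), (z ^ (q + 2))⁻¹ * branchSum a d z‖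
      ≤ 2 * Real.pi * (R ^ q)⁻¹ * ∑' m, (‖a m‖ ^ 2)⁻¹ := by
  obtain ⟨u, hu, hub⟩ := exists_summable_bound_on_sphere hd hB hR hne
  have hmem : ∀ θ, circleMap 0 R θ ∈ Metric.sphere (0 : ℂ) R := fun θ =>
    circleMap_mem_sphere 0 hR.le θ
  have h0 : ∀ z ∈ Metric.sphere (0 : ℂ) R, z ≠ 0 := fun z hz =>
    norm_pos_iff.1 (by rw [show ‖z‖ = R by simpa using hz]; exact hR)
  have hcont : ∀ m, ContinuousOn (fun z => (z ^ (q + 2))⁻¹ * branchTerm a d m z)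
      (Metric.sphere 0 R) := fun m =>
    (ContinuousOn.inv₀ (by fun_prop) fun z hz => pow_ne_zero _ (h0 z hz)).mul
      (continuousOn_branchTerm hne m)
  -- The counterterms are constants, and `z ^ (-(q + 2))` integrates to zero.
  have hterm : ∀ m, (∮ z in C(0, R), (z ^ (q + 2))⁻¹ * branchTerm a d m z)
      = ∮ z in C(0, R), (z ^ (q + 2))⁻¹ * (z - a m)⁻¹ := fun m => by
    simp only [branchTerm, mul_add]
    rw [circleIntegral.integral_add
      ((continuousOn_inv_pow_mul_inv_sub hR (hne m) _).circleIntegrable hR.le)]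
    · have : (∮ z in C(0, R), (z ^ (q + 2))⁻¹ * (d * (m : ℂ) + d * 1)⁻¹)
          = (∮ z in C(0, R), (z ^ (q + 2))⁻¹) * (d * (m : ℂ) + d * 1)⁻¹ := by
        simp_rw [mul_comm _ (d * (m : ℂ) + d * 1)⁻¹]
        rw [circleIntegral.integral_const_mul]
      rw [this, circleIntegral_inv_pow_of_two_le (by omega), zero_mul, add_zero]
    · refine ContinuousOn.circleIntegrable hR.le (ContinuousOn.mul ?_ continuousOn_const)
      exact ContinuousOn.inv₀ (by fun_prop) fun z hz => pow_ne_zero _ (h0 z hz)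
  have hsum : HasSum (fun m => ∮ z in C(0, R), (z ^ (q + 2))⁻¹ * (z - a m)⁻¹)
      (∮ z in C(0, R), (z ^ (q + 2))⁻¹ * branchSum a d z) := by
    simp_rw [← hterm]
    refine intervalIntegral.hasSum_integral_of_dominated_convergence
      (fun m _ => R * ((R ^ (q + 2))⁻¹ * u m)) (fun m => ?_) (fun m => ?_) ?_ ?_ ?_
    · refine Continuous.aestronglyMeasurable ?_
      simp only [deriv_circleMap]
      refine Continuous.smul (by fun_prop : Continuous fun θ => circleMap 0 R θ * Complex.I) ?_
      exact (hcont m).comp_continuous (continuous_circleMap 0 R) hmem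
    · refine Eventually.of_forall fun θ _ => ?_
      have h1 : ‖circleMap 0 R θ‖ = R := by simpa using hmem θ
      rw [norm_smul, norm_mul, deriv_circleMap, norm_mul, Complex.norm_I, h1, mul_one, norm_inv,
        norm_pow, h1]
      gcongr
      exact hub m _ (hmem θ)
    · exact Eventually.of_forall fun θ _ => (hu.mul_left _).mul_left _
    · exact intervalIntegrable_const
    · refine Eventually.of_forall fun θ _ => ?_
      exact ((summable_branchTerm hd hB _).hasSum.mul_left _).const_smul _
  rw [← hsum.tsum_eq, ← tsum_mul_left]
  exact tsum_of_norm_bounded ((summable_norm_inv_sq hd hB).mul_left _).hasSum fun m =>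
    norm_circleIntegral_inv_pow_mul_inv_sub_le hR (hne m) q

end BranchSum

/-! ### Partial fractions with a polynomial remainder -/

/-- An entire function whose high order Cauchy integrals over a sequence of circles tend to zero
is a polynomial. -/
theorem exists_polynomial_of_tendsto_circleIntegral {E : ℂ → ℂ} (hE : Differentiable ℂ E)
    {R : ℕ → ℝ} (hR : ∀ N, 0 < R N) {Q : ℕ}
    (h : ∀ q ≥ Q, Tendsto (fun N => ∮ z in C(0, R N), (z ^ (q + 2))⁻¹ * E z) atTop (𝓝 0)) :
    ∃ p : Polynomial ℂ, ∀ z, E z = p.eval z := by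
  have hzero : ∀ n ≥ Q + 1, iteratedDeriv n E 0 = 0 := by
    intro n hn
    obtain ⟨q, rfl⟩ : ∃ q, n = q + 1 := ⟨n - 1, by omega⟩
    have h1 : ∀ N, (∮ z in C(0, R N), (z ^ (q + 2))⁻¹ * E z)
        = (2 * Real.pi * Complex.I / ((q + 1).factorial : ℂ)) * iteratedDeriv (q + 1) E 0 := by
      intro N
      have := DiffContOnCl.circleIntegral_one_div_sub_center_pow_smul (c := 0) (hR N) (q + 1)
        hE.diffContOnCl
      simpa using this
    have h2 := h q (by omega)
    simp_rw [h1] at h2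
    have h3 := tendsto_nhds_unique h2 tendsto_const_nhds
    rcases mul_eq_zero.1 h3.symm with h4 | h4
    · exact absurd h4 (div_ne_zero (by simp [Real.pi_ne_zero])
        (Nat.cast_ne_zero.2 (Nat.factorial_ne_zero _)))
    · exact h4
  refine ⟨∑ n ∈ Finset.range (Q + 1),
    Polynomial.C ((n.factorial : ℂ)⁻¹ * iteratedDeriv n E 0) * Polynomial.X ^ n, fun z => ?_⟩
  rw [← Complex.taylorSeries_eq_of_entire' 0 z hE, tsum_eq_sum (s := Finset.range (Q + 1))]
  · simp [Polynomial.eval_finsetSum]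
  · intro n hn
    rw [hzero n (by simpa using hn)]
    simp

/-- Assign to each point the value of its own local extension. This value is the punctured limit of
`F`, so near `z₀` the assigned values agree with the single analytic function `g z₀`. -/
theorem exists_differentiable_extension {F : ℂ → ℂ}
    (h : ∀ z₀, ∃ g : ℂ → ℂ, AnalyticAt ℂ g z₀ ∧ F =ᶠ[𝓝[≠] z₀] g) :
    ∃ E : ℂ → ℂ, Differentiable ℂ E ∧ ∀ z, ContinuousAt F z → E z = F z := by
  choose g hg hFg using h
  have hval : ∀ z₀ (k : ℂ → ℂ), ContinuousAt k z₀ → F =ᶠ[𝓝[≠] z₀] k → g z₀ z₀ = k z₀ := by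
    intro z₀ k hk hFk
    have h1 : Tendsto (g z₀) (𝓝[≠] z₀) (𝓝 (g z₀ z₀)) :=
      (hg z₀).continuousAt.tendsto.mono_left nhdsWithin_le_nhds
    have h2 : Tendsto k (𝓝[≠] z₀) (𝓝 (k z₀)) := hk.tendsto.mono_left nhdsWithin_le_nhds
    exact tendsto_nhds_unique h1 (h2.congr' ((hFk.symm.trans (hFg z₀))))
  refine ⟨fun z => g z z, fun z₀ => ?_, fun z hz => hval z F hz EventuallyEq.rfl⟩
  refine (hg z₀).differentiableAt.congr_of_eventuallyEq ?_
  have h1 := eventually_eventually_nhdsWithin.2 (hFg z₀)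
  rw [eventually_nhdsWithin_iff] at h1
  filter_upwards [h1, (hg z₀).eventually_analyticAt] with z hz hgz
  rcases eq_or_ne z z₀ with rfl | hne
  · rfl
  · refine hval z (g z₀) hgz.continuousAt ?_
    have h2 := hz hne
    have h3 : 𝓝[{z₀}ᶜ] z = 𝓝 z := isOpen_compl_singleton.nhdsWithin_eq hne
    rw [h3] at h2
    exact h2.filter_mono nhdsWithin_le_nhds

open Classical in
/-- Partial fraction expansion of a function with simple poles along finitely many asymptotic
branches, constant residues on each branch, and polynomial growth on a sequence of circles. -/
theorem exists_partialFraction {ι : Type*} [Fintype ι] {a : ι → ℕ → ℂ} {d ξ s : ι → ℂ}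
    (hbr : ∀ j, IsAsymptoticBranch (a j) (d j) (ξ j)) (hinj : ∀ j, Function.Injective (a j))
    {f : ℂ → ℂ}
    (hloc : ∀ z₀, ∃ g : ℂ → ℂ, AnalyticAt ℂ g z₀ ∧ f =ᶠ[𝓝[≠] z₀]
      fun z => g z + (∑ j, s j * if ∃ m, a j m = z₀ then 1 else 0) * (z - z₀)⁻¹)
    (hreg : ∀ z₀, (∀ j m, a j m ≠ z₀) → AnalyticAt ℂ f z₀)
    {R : ℕ → ℝ} (hR : ∀ N, 0 < R N) (hRt : Tendsto R atTop atTop)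
    (hcirc : ∀ N j m, ‖a j m‖ ≠ R N) {C : ℝ} {k : ℕ}
    (hC : ∀ N z, ‖z‖ = R N → ‖f z‖ ≤ C * R N ^ k) :
    ∃ p : Polynomial ℂ, ∀ z, (∀ j m, a j m ≠ z) →
      f z = p.eval z + ∑ j, s j * branchSum (a j) (d j) z := by
  choose B _ hB using fun j => (hbr j).exists_bound
  have hd : ∀ j, d j ≠ 0 := fun j => (hbr j).1
  obtain ⟨E, hE, hEF⟩ := exists_differentiable_extension
    (F := fun z => f z - ∑ j, s j * branchSum (a j) (d j) z) (fun z₀ => by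
      obtain ⟨g, hg, hfg⟩ := hloc z₀
      choose g' hg' hS using fun j => branchSum_eq_add (hd j) (hB j) (hinj j) z₀
      refine ⟨fun z => g z - ∑ j, s j * g' j z,
        hg.sub (Finset.analyticAt_fun_sum _ fun j _ => analyticAt_const.mul (hg' j)), ?_⟩
      have hS' : ∀ᶠ z in 𝓝[≠] z₀, ∀ j, branchSum (a j) (d j) z
          = g' j z + (if ∃ m, a j m = z₀ then 1 else 0) * (z - z₀)⁻¹ :=
        eventually_all.2 fun j => (hS j).filter_mono nhdsWithin_le_nhds
      filter_upwards [hfg, hS'] with z h1 h2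
      have h3 : ∑ j, s j * branchSum (a j) (d j) z = ∑ j, s j * g' j z
          + (∑ j, s j * if ∃ m, a j m = z₀ then 1 else 0) * (z - z₀)⁻¹ := by
        rw [Finset.sum_mul, ← Finset.sum_add_distrib]
        exact Finset.sum_congr rfl fun j _ => by rw [h2 j]; ring
      rw [h1, h3]
      ring)
  have han : ∀ z, (∀ j m, a j m ≠ z) →
      AnalyticAt ℂ (fun z => ∑ j, s j * branchSum (a j) (d j) z) z := fun z hz =>
    Finset.analyticAt_fun_sum _ fun j _ => analyticAt_const.mul
      (analyticAt_branchSum (hd j) (hB j) (hinj j) (hz j))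
  have hEq : ∀ z, (∀ j m, a j m ≠ z) →
      E z = f z - ∑ j, s j * branchSum (a j) (d j) z := fun z hz =>
    hEF z ((hreg z hz).sub (han z hz)).continuousAt
  suffices h : ∃ p : Polynomial ℂ, ∀ z, E z = p.eval z by
    obtain ⟨p, hp⟩ := h
    exact ⟨p, fun z hz => by rw [← hp, hEq z hz]; ring⟩
  -- The integrals of `f` are `O(R ^ (k - q - 1))` and those of the branch sums `O(R ^ (-q))`; `q ≥
  -- k + 1` makes both exponents negative.
  refine exists_polynomial_of_tendsto_circleIntegral hE hR (Q := k + 1) fun q hq => ?_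
  have hoff : ∀ N, ∀ z ∈ Metric.sphere (0 : ℂ) (R N), ∀ j m, a j m ≠ z := fun N z hz j m h =>
    hcirc N j m (by rw [h]; simpa using hz)
  have hpow : ∀ N, ContinuousOn (fun z : ℂ => (z ^ (q + 2))⁻¹) (Metric.sphere 0 (R N)) := fun N =>
    ContinuousOn.inv₀ (by fun_prop) fun z hz => pow_ne_zero _
      (norm_pos_iff.1 (by rw [show ‖z‖ = R N by simpa using hz]; exact hR N))
  have hsplit : ∀ N, (∮ z in C(0, R N), (z ^ (q + 2))⁻¹ * E z)
      = (∮ z in C(0, R N), (z ^ (q + 2))⁻¹ * f z)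
        - ∑ j, s j * ∮ z in C(0, R N), (z ^ (q + 2))⁻¹ * branchSum (a j) (d j) z := fun N => by
    have hci : ∀ j, CircleIntegrable (fun z => (z ^ (q + 2))⁻¹ * branchSum (a j) (d j) z)
        0 (R N) := fun j => by
      refine ContinuousOn.circleIntegrable (hR N).le ((hpow N).mul fun z hz => ?_)
      exact (analyticAt_branchSum (hd j) (hB j) (hinj j)
        (hoff N z hz j)).continuousAt.continuousWithinAt
    have hsum : (∑ j, s j * ∮ z in C(0, R N), (z ^ (q + 2))⁻¹ * branchSum (a j) (d j) z)
        = ∮ z in C(0, R N), ∑ j, s j * ((z ^ (q + 2))⁻¹ * branchSum (a j) (d j) z) := by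
      rw [circleIntegral.integral_fun_sum]
      · simp_rw [circleIntegral.integral_const_mul]
      · exact fun j _ => (hci j).const_mul _
    rw [hsum, ← circleIntegral.integral_sub]
    · refine circleIntegral.integral_congr (hR N).le fun z hz => ?_
      rw [hEq z (hoff N z hz), mul_sub, Finset.mul_sum]
      congr 1
      exact Finset.sum_congr rfl fun j _ => by ring
    · refine ContinuousOn.circleIntegrable (hR N).le ((hpow N).mul fun z hz => ?_)
      exact (hreg z (hoff N z hz)).continuousAt.continuousWithinAt
    · exact CircleIntegrable.fun_sum _ fun j _ => (hci j).const_mul _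
  simp_rw [hsplit]
  have hinv : Tendsto (fun N => (R N)⁻¹) atTop (𝓝 0) := hRt.inv_tendsto_atTop
  have h1 : Tendsto (fun N => ∮ z in C(0, R N), (z ^ (q + 2))⁻¹ * f z) atTop (𝓝 0) := by
    have hb : ∀ N, ‖∮ z in C(0, R N), (z ^ (q + 2))⁻¹ * f z‖
        ≤ 2 * Real.pi * C * (R N)⁻¹ ^ (q + 1 - k) := fun N => by
      have hRN := hR N
      refine (circleIntegral.norm_integral_le_of_norm_le_const (hR N).le
        (C := (R N ^ (q + 2))⁻¹ * (C * R N ^ k)) fun z hz => ?_).trans (le_of_eq ?_)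
      · have hz' : ‖z‖ = R N := by simpa using hz
        rw [norm_mul, norm_inv, norm_pow, hz']
        exact mul_le_mul_of_nonneg_left (hC N z hz') (by positivity)
      · obtain ⟨i, rfl⟩ : ∃ i, q = k + i := ⟨q - k, by omega⟩
        rw [show k + i + 1 - k = i + 1 by omega, inv_pow]
        field_simp
        ring
    refine squeeze_zero_norm hb ?_
    have := (hinv.pow (q + 1 - k)).const_mul (2 * Real.pi * C)
    rwa [zero_pow (by omega), mul_zero] at this
  have h2 : ∀ j, Tendsto (fun N => ∮ z in C(0, R N), (z ^ (q + 2))⁻¹ * branchSum (a j) (d j) z)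
      atTop (𝓝 0) := fun j => by
    refine squeeze_zero_norm (fun N => norm_circleIntegral_branchSum_le (hd j) (hB j) (hR N)
      (fun m => hcirc N j m) q) ?_
    have := ((hinv.pow q).const_mul (2 * Real.pi)).mul_const (∑' m, (‖a j m‖ ^ 2)⁻¹)
    simpa [zero_pow (show q ≠ 0 by omega)] using this
  have h3 := h1.sub (tendsto_finsetSum Finset.univ fun j _ => (h2 j).const_mul (s j))
  simpa using h3

theorem exists_logDeriv_eq_add {G : ℂ → ℂ} {z₀ : ℂ} (hG : MeromorphicAt G z₀) {n : ℤ}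
    (hn : meromorphicOrderAt G z₀ = n) :
    ∃ g : ℂ → ℂ, AnalyticAt ℂ g z₀ ∧
      logDeriv G =ᶠ[𝓝[≠] z₀] fun z => g z + n * (z - z₀)⁻¹ := by
  obtain ⟨h, hh, hh0, hGh⟩ := (meromorphicOrderAt_eq_int_iff hG).1 hn
  refine ⟨logDeriv h, hh.deriv.div hh hh0, ?_⟩
  have hGh' : G =ᶠ[𝓝[≠] z₀] fun z => (z - z₀) ^ n * h z := hGh
  have hev : ∀ᶠ z in 𝓝[≠] z₀, AnalyticAt ℂ h z ∧ h z ≠ 0 :=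
    (hh.eventually_analyticAt.and (hh.continuousAt.eventually_ne hh0)).filter_mono
      nhdsWithin_le_nhds
  filter_upwards [hGh', hGh'.nhdsNE_deriv, hev, self_mem_nhdsWithin] with z h1 h2 h3 hz
  have hz' : z - z₀ ≠ 0 := sub_ne_zero.2 hz
  have hdiff : DifferentiableAt ℂ (fun z => z - z₀) z := by fun_prop
  have e1 : logDeriv G z = logDeriv (fun z => (z - z₀) ^ n * h z) z := by
    simp only [logDeriv_apply, h1, h2]
  rw [e1, logDeriv_mul (f := fun z => (z - z₀) ^ n) (g := h) z (zpow_ne_zero _ hz') h3.2 (hdiff.zpow (Or.inl hz'))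
    h3.1.differentiableAt, logDeriv_fun_zpow hdiff, add_comm]
  simp [logDeriv_apply]

theorem IsMeromorphicSimple.analyticAt {G : ℂ → ℂ} (hG : IsMeromorphicSimple G) {z : ℂ}
    (hz : meromorphicOrderAt G z = 0) : AnalyticAt ℂ G z ∧ G z ≠ 0 :=
  ⟨(hG.1 (Set.mem_univ z)).meromorphicOrderAt_nonneg_iff_analyticAt.1 hz.ge,
    (hG.1 (Set.mem_univ z)).meromorphicOrderAt_eq_zero_iff.1 hz⟩

/-! ### Behaviour along rays and the jump of the logarithm -/

/-- With the next lemma: the cut of `u ↦ log (-(u / d))` is exactly the ray through `d`, so the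
admissible directions are those where this logarithm is continuous. -/
theorem arg_ne_of_neg_div_mem_slitPlane {u d : ℂ} (hu : u ≠ 0) (hd : d ≠ 0)
    (h : -(u / d) ∈ Complex.slitPlane) : u.arg ≠ d.arg := by
  intro harg
  have h1 := (Complex.arg_eq_arg_iff hu hd).1 harg
  have hun : (‖u‖ : ℂ) ≠ 0 := by simpa using hu
  have hdn : (‖d‖ : ℂ) ≠ 0 := by simpa using hd
  have h2 : -(u / d) = ((-(‖u‖ / ‖d‖) : ℝ) : ℂ) := by
    nth_rw 1 [← h1]
    push_cast
    field_simp
  rw [h2, Complex.ofReal_mem_slitPlane] at h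
  have : 0 ≤ ‖u‖ / ‖d‖ := by positivity
  linarith

theorem neg_div_mem_slitPlane_of_arg_ne {u d : ℂ} (hu : u ≠ 0) (hd : d ≠ 0)
    (h : u.arg ≠ d.arg) : -(u / d) ∈ Complex.slitPlane := by
  by_contra hns
  rw [Complex.mem_slitPlane_iff, not_or, not_lt, not_not] at hns
  obtain ⟨hre, him⟩ := hns
  simp only [Complex.neg_re, Complex.neg_im] at hre him
  have h1 : u / d = ((u / d).re : ℝ) := by
    apply Complex.ext <;> simp
    linarith
  have h2 : 0 < (u / d).re := by
    refine lt_of_le_of_ne (by linarith) fun h0 => div_ne_zero hu hd ?_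
    rw [h1, ← h0, Complex.ofReal_zero]
  apply h
  rw [← Complex.arg_real_mul d h2, ← h1, div_mul_cancel₀ _ hd]

theorem AwayFromRay.of_ray {c : ℝ} {d u : ℂ} (hu : ‖u‖ = 1) {r : ℝ} (hr : 0 ≤ r)
    (h : ∀ r x : ℝ, 0 ≤ r → 0 ≤ x → c * (r + x) ≤ ‖r * u - d * x‖) :
    AwayFromRay c d (r * u) := fun x hx => by
  rw [norm_mul, hu, mul_one, Complex.norm_of_nonneg hr]
  exact h r x hr hx

/-- Asymptotics of the Mittag-Leffler sum along a ray which is not in the direction of the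
branch. -/
theorem IsAsymptoticBranch.tendsto_branchSum_ray {a : ℕ → ℂ} {d ξ u : ℂ}
    (h : IsAsymptoticBranch a d ξ) (hu : ‖u‖ = 1) (harg : u.arg ≠ d.arg) :
    (∀ᶠ r : ℝ in atTop, ∀ m, a m ≠ r * u) ∧
    Tendsto (fun r : ℝ => branchSum a d (r * u)
      - d⁻¹ * (Real.log r + (Complex.log (-(u / d)) + Real.eulerMascheroniConstant)))
      atTop (𝓝 0) := by
  have hd := h.1
  have hu0 : u ≠ 0 := norm_pos_iff.1 (by rw [hu]; exact one_pos)
  obtain ⟨c, hc, hcb⟩ := exists_pos_le_norm_sub (isCompact_singleton (x := u)) hd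
    (by simpa using hu) (by simpa using harg)
  obtain ⟨δ, C, ρ, hδ, hC, hρ, hS⟩ := h.exists_branchSum_sub_le hc
  obtain ⟨C', hC', hS'⟩ := exists_branchSum_linear_le hd hc
  have haw : ∀ r : ℝ, 0 ≤ r → AwayFromRay c d (r * u) := fun r hr =>
    AwayFromRay.of_ray hu hr (hcb u rfl)
  have hnorm : ∀ r : ℝ, 0 ≤ r → ‖(r : ℂ) * u‖ = r := fun r hr => by
    rw [norm_mul, hu, mul_one, Complex.norm_of_nonneg hr]
  refine ⟨?_, ?_⟩
  · filter_upwards [eventually_ge_atTop ρ] with r hr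
    have hr0 : 0 ≤ r := by linarith
    exact (hS _ (by rwa [hnorm r hr0]) (haw r hr0)).1
  · have hlim : Tendsto (fun r : ℝ => C * r ^ (-(1 + δ)) + ‖ξ‖ * r⁻¹ + C' * r ^ (-(1 / 2) : ℝ))
        atTop (𝓝 0) := by
      have h1 := (tendsto_rpow_neg_atTop (show 0 < 1 + δ by linarith)).const_mul C
      have h2 := tendsto_inv_atTop_zero (𝕜 := ℝ) |>.const_mul ‖ξ‖
      have h3 := (tendsto_rpow_neg_atTop (show (0 : ℝ) < 1 / 2 by norm_num)).const_mul C'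
      simpa using (h1.add h2).add h3
    refine squeeze_zero_norm' ?_ hlim
    filter_upwards [eventually_ge_atTop ρ] with r hr
    have hr0 : 0 < r := by linarith
    have e1 := (hS _ (by rwa [hnorm r hr0.le]) (haw r hr0.le)).2
    have e2 := hS' _ (by rw [hnorm r hr0.le]; linarith) (haw r hr0.le)
    have hlog : Complex.log (-(r * u / d)) = Real.log r + Complex.log (-(u / d)) := by
      rw [← Complex.log_ofReal_mul hr0 (neg_ne_zero.2 (div_ne_zero hu0 hd))]
      congr 1
      ring
    rw [hlog] at e2
    rw [hnorm r hr0.le] at e1 e2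
    set S₀ := branchSum (fun m => d * ((m : ℂ) + 1)) d (r * u)
    calc _ = ‖(branchSum a d (r * u) - S₀ + ξ / (r * u)) - ξ / (r * u)
          + (S₀ - d⁻¹ * (Real.log r + Complex.log (-(u / d)) + Real.eulerMascheroniConstant))‖ := by
          congr 1; ring
      _ ≤ _ := by
        refine (norm_add_le _ _).trans (add_le_add ((norm_sub_le _ _).trans
          (add_le_add e1 ?_)) e2)
        rw [norm_div, hnorm r hr0.le, div_eq_mul_inv]

/-- Dividing by `R N` kills the logarithm, so `p.divX` tends to `0` along an unbounded sequence and
must vanish. With `p` constant, a nonzero `L` would leave an unbounded logarithm. -/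
theorem Polynomial.eq_C_of_tendsto_add_log {p : Polynomial ℂ} {u L c : ℂ} (hu : u ≠ 0)
    {R : ℕ → ℝ} (hR : Tendsto R atTop atTop)
    (h : Tendsto (fun N => p.eval (R N * u) + (Real.log (R N) * L + c)) atTop (𝓝 0)) :
    ∃ e : ℂ, p = Polynomial.C e ∧ L = 0 ∧ e + c = 0 := by
  have hinv : Tendsto (fun N => ((R N : ℂ))⁻¹) atTop (𝓝 0) := by
    have : Tendsto (fun N => (((R N)⁻¹ : ℝ) : ℂ)) atTop (𝓝 ((0 : ℝ) : ℂ)) :=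
      (Complex.continuous_ofReal.tendsto _).comp hR.inv_tendsto_atTop
    simpa using this
  have hlog : Tendsto (fun N => (Real.log (R N) : ℂ) * (R N : ℂ)⁻¹) atTop (𝓝 0) := by
    have h1 : Tendsto (fun N => Real.log (R N) / R N) atTop (𝓝 0) :=
      (Real.isLittleO_log_id_atTop.tendsto_div_nhds_zero).comp hR
    have : Tendsto (fun N => ((Real.log (R N) / R N : ℝ) : ℂ)) atTop (𝓝 ((0 : ℝ) : ℂ)) :=
      (Complex.continuous_ofReal.tendsto _).comp h1
    simpa [div_eq_mul_inv] using this
  have hdivX : Tendsto (fun N => p.divX.eval (R N * u)) atTop (𝓝 0) := by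
    have h1 := ((h.mul hinv).sub ((hlog.mul_const L).add
      (hinv.const_mul (c + p.coeff 0)))).mul_const u⁻¹
    simp only [mul_zero, zero_mul, add_zero, sub_zero] at h1
    refine h1.congr' ?_
    filter_upwards [hR.eventually_gt_atTop 0] with N hN
    have hN' : (R N : ℂ) ≠ 0 := by exact_mod_cast hN.ne'
    have h2 : p.eval (R N * u) = p.divX.eval (R N * u) * (R N * u) + p.coeff 0 := by
      conv_lhs => rw [← p.divX_mul_X_add]
      simp
    rw [h2]
    field_simp
    ring
  have hnorm : Tendsto (fun N => ‖(R N : ℂ) * u‖) atTop atTop := by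
    have h1 : Tendsto (fun N => R N * ‖u‖) atTop atTop := hR.atTop_mul_const (norm_pos_iff.2 hu)
    refine h1.congr' ?_
    filter_upwards [hR.eventually_ge_atTop 0] with N hN
    rw [norm_mul, Complex.norm_of_nonneg hN]
  have hdeg : p.divX.degree ≤ 0 := by
    by_contra hdeg
    exact not_tendsto_nhds_of_tendsto_atTop
      (Polynomial.tendsto_norm_atTop _ (not_le.1 hdeg) hnorm) _ hdivX.norm
  have hdX : p.divX = 0 := by
    rw [Polynomial.eq_C_of_degree_le_zero hdeg] at hdivX ⊢
    simp only [Polynomial.eval_C] at hdivX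
    rw [tendsto_nhds_unique tendsto_const_nhds hdivX, Polynomial.C_0]
  have hp : p = Polynomial.C (p.coeff 0) := by
    conv_lhs => rw [← p.divX_mul_X_add, hdX]
    simp
  refine ⟨p.coeff 0, hp, ?_⟩
  rw [hp] at h
  simp only [Polynomial.eval_C] at h
  have hL : L = 0 := by
    by_contra hL
    have h1 : Tendsto (fun N => (Real.log (R N) : ℂ) * L) atTop (𝓝 (0 - (p.coeff 0 + c))) := by
      refine (h.sub_const (p.coeff 0 + c)).congr fun N => ?_
      ring
    have h2 : Tendsto (fun N => Real.log (R N) * ‖L‖) atTop atTop :=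
      (Real.tendsto_log_atTop.comp hR).atTop_mul_const (norm_pos_iff.2 hL)
    refine not_tendsto_nhds_of_tendsto_atTop (tendsto_atTop_mono (fun N => ?_) h2) _ h1.norm
    rw [norm_mul, Complex.norm_real]
    gcongr
    exact le_abs_self _
  refine ⟨hL, ?_⟩
  rw [hL] at h
  simp only [mul_zero, zero_add] at h
  exact tendsto_const_nhds_iff.1 h

open Classical in
/-- A combination of logarithms that is constant off the branch directions has no jump, so its
coefficients cancel in each direction. -/
theorem sum_div_eq_zero_of_log_relation {ι : Type*} [Fintype ι] {d s : ι → ℂ} (hd : ∀ j, d j ≠ 0)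
    {e γ : ℂ} (h : ∀ u : ℂ, ‖u‖ = 1 → (∀ j, u.arg ≠ (d j).arg) →
      e + ∑ j, s j * ((d j)⁻¹ * (Complex.log (-(u / d j)) + γ)) = 0) (i : ι) :
    (∑ j, if (d j).arg = (d i).arg then s j * (d j)⁻¹ else 0) = 0 := by
  set u₀ : ℂ := d i / ‖d i‖ with hu₀
  have hdn : ∀ j, (‖d j‖ : ℂ) ≠ 0 := fun j => by simpa using hd j
  have hu₀1 : ‖u₀‖ = 1 := by
    rw [hu₀, norm_div, Complex.norm_real, norm_norm, div_self (norm_ne_zero_iff.2 (hd i))]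
  have hu₀0 : u₀ ≠ 0 := div_ne_zero (hd i) (hdn i)
  have hu₀arg : u₀.arg = (d i).arg := by
    rw [hu₀, div_eq_inv_mul, ← Complex.ofReal_inv,
      Complex.arg_real_mul _ (inv_pos.2 (norm_pos_iff.2 (hd i)))]
  set U : ℝ → ℂ := fun η => Complex.exp (η * Complex.I) * u₀ with hU
  have hU1 : ∀ η, ‖U η‖ = 1 := fun η => by
    rw [hU]; simp only [norm_mul, Complex.norm_exp_ofReal_mul_I, hu₀1, mul_one]
  have hU0 : ∀ η, U η ≠ 0 := fun η => norm_pos_iff.1 (by rw [hU1]; exact one_pos)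
  have hUc : Continuous U := by rw [hU]; fun_prop
  have hU00 : U 0 = u₀ := by simp [hU]
  have hsame : ∀ j, (d j).arg = (d i).arg → u₀ / d j = ((‖d j‖⁻¹ : ℝ) : ℂ) := fun j hj => by
    have h1 := (Complex.arg_eq_arg_iff (hd j) hu₀0).1 (hj.trans hu₀arg.symm)
    rw [hu₀1] at h1
    rw [← h1]
    have := hd j
    push_cast
    field_simp
  have hdiff : ∀ j, (d j).arg ≠ (d i).arg → -(u₀ / d j) ∈ Complex.slitPlane := fun j hj =>
    neg_div_mem_slitPlane_of_arg_ne hu₀0 (hd j) (by rw [hu₀arg]; exact hj.symm)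
  -- A turn by `η` off the branch direction gives `-(u / d j)` the argument `η - π`, a turn by `-η`
  -- gives `π - η`; the difference tends to `-2π`. Branches in other directions are continuous at
  -- `u₀` and contribute no jump.
  have hlogp : ∀ j, (d j).arg = (d i).arg → ∀ η ∈ Set.Ioo (0 : ℝ) Real.pi,
      Complex.log (-(U η / d j)) = Real.log ‖d j‖⁻¹ + (η - Real.pi : ℝ) * Complex.I := by
    intro j hj η hη
    have e1 : -(U η / d j) = ((‖d j‖⁻¹ : ℝ) : ℂ) * Complex.exp ((η - Real.pi : ℝ) * Complex.I) := by
      rw [hU, mul_div_assoc, hsame j hj]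
      push_cast
      rw [sub_mul, Complex.exp_sub, Complex.exp_pi_mul_I]
      ring
    rw [e1, Complex.log_ofReal_mul (inv_pos.2 (norm_pos_iff.2 (hd j))) (Complex.exp_ne_zero _),
      Complex.log_exp] <;> simp <;> linarith [hη.1, hη.2]
  have hlogm : ∀ j, (d j).arg = (d i).arg → ∀ η ∈ Set.Ioo (0 : ℝ) Real.pi,
      Complex.log (-(U (-η) / d j)) = Real.log ‖d j‖⁻¹ + (Real.pi - η : ℝ) * Complex.I := by
    intro j hj η hη
    have e1 : -(U (-η) / d j)
        = ((‖d j‖⁻¹ : ℝ) : ℂ) * Complex.exp ((Real.pi - η : ℝ) * Complex.I) := by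
      rw [hU, mul_div_assoc, hsame j hj]
      push_cast
      rw [sub_mul, Complex.exp_sub, Complex.exp_pi_mul_I, neg_mul, Complex.exp_neg]
      ring
    rw [e1, Complex.log_ofReal_mul (inv_pos.2 (norm_pos_iff.2 (hd j))) (Complex.exp_ne_zero _),
      Complex.log_exp] <;> simp <;> linarith [hη.1, hη.2]
  have hslit : ∀ j, ∀ᶠ η : ℝ in 𝓝[>] 0, -(U η / d j) ∈ Complex.slitPlane ∧
      -(U (-η) / d j) ∈ Complex.slitPlane := by
    intro j
    by_cases hj : (d j).arg = (d i).arg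
    · filter_upwards [Ioo_mem_nhdsGT Real.pi_pos] with η hη
      have him : ∀ z : ℂ, (Complex.log z).im ≠ Real.pi → z ≠ 0 → z ∈ Complex.slitPlane :=
        fun z hz hz0 => Complex.mem_slitPlane_iff_arg.2 ⟨by rwa [Complex.log_im] at hz, hz0⟩
      refine ⟨him _ ?_ (neg_ne_zero.2 (div_ne_zero (hU0 _) (hd j))),
        him _ ?_ (neg_ne_zero.2 (div_ne_zero (hU0 _) (hd j)))⟩
      · rw [hlogp j hj η hη]
        simp only [Complex.add_im, Complex.ofReal_im,
          Complex.im_ofReal_mul, Complex.I_im, mul_one, zero_add]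
        linarith [hη.2, Real.pi_pos]
      · rw [hlogm j hj η hη]
        simp only [Complex.add_im, Complex.ofReal_im, Complex.im_ofReal_mul, Complex.I_im, mul_one,
          zero_add]
        linarith [hη.1]
    · have h1 : ∀ᶠ z in 𝓝 (-(u₀ / d j)), z ∈ Complex.slitPlane :=
        Complex.isOpen_slitPlane.mem_nhds (hdiff j hj)
      have h2 : Tendsto (fun η => -(U η / d j)) (𝓝 0) (𝓝 (-(u₀ / d j))) := by
        rw [← hU00]; exact (Continuous.tendsto (by fun_prop) 0)
      have h3 : Tendsto (fun η => -(U (-η) / d j)) (𝓝 0) (𝓝 (-(u₀ / d j))) := by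
        have : Continuous fun η => -(U (-η) / d j) := by fun_prop
        simpa [hU00] using this.tendsto 0
      exact ((h2.eventually h1).and (h3.eventually h1)).filter_mono nhdsWithin_le_nhds
  have hzero : ∀ᶠ η : ℝ in 𝓝[>] 0, ∑ j, s j * (d j)⁻¹ *
      (Complex.log (-(U η / d j)) - Complex.log (-(U (-η) / d j))) = 0 := by
    filter_upwards [eventually_all.2 hslit] with η hη
    have h1 := h (U η) (hU1 _) fun j =>
      arg_ne_of_neg_div_mem_slitPlane (hU0 _) (hd j) (hη j).1
    have h2 := h (U (-η)) (hU1 _) fun j =>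
      arg_ne_of_neg_div_mem_slitPlane (hU0 _) (hd j) (hη j).2
    have h3 : ∑ j, s j * (d j)⁻¹ * (Complex.log (-(U η / d j)) - Complex.log (-(U (-η) / d j)))
        = (e + ∑ j, s j * ((d j)⁻¹ * (Complex.log (-(U η / d j)) + γ)))
          - (e + ∑ j, s j * ((d j)⁻¹ * (Complex.log (-(U (-η) / d j)) + γ))) := by
      rw [add_sub_add_left_eq_sub, ← Finset.sum_sub_distrib]
      exact Finset.sum_congr rfl fun j _ => by ring
    rw [h3, h1, h2, sub_zero]
  have hlim : ∀ j, Tendsto (fun η : ℝ => s j * (d j)⁻¹ *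
      (Complex.log (-(U η / d j)) - Complex.log (-(U (-η) / d j)))) (𝓝[>] 0)
      (𝓝 ((if (d j).arg = (d i).arg then s j * (d j)⁻¹ else 0) * (-(2 * Real.pi * Complex.I)))) := by
    intro j
    split_ifs with hj
    · have h1 : Tendsto (fun η : ℝ => s j * (d j)⁻¹ * (2 * (η - Real.pi : ℝ) * Complex.I)) (𝓝[>] 0)
          (𝓝 (s j * (d j)⁻¹ * (2 * (0 - Real.pi : ℝ) * Complex.I))) := by
        refine Tendsto.mono_left ?_ nhdsWithin_le_nhds
        exact Continuous.tendsto (by fun_prop) 0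
      have e : s j * (d j)⁻¹ * -(2 * Real.pi * Complex.I)
          = s j * (d j)⁻¹ * (2 * (0 - Real.pi : ℝ) * Complex.I) := by push_cast; ring
      rw [e]
      refine h1.congr' ?_
      filter_upwards [Ioo_mem_nhdsGT Real.pi_pos] with η hη
      rw [hlogp j hj η hη, hlogm j hj η hη]
      push_cast
      ring
    · have hc : ContinuousAt Complex.log (-(u₀ / d j)) := continuousAt_clog (hdiff j hj)
      have h2 : Tendsto (fun η => -(U η / d j)) (𝓝 0) (𝓝 (-(u₀ / d j))) := by
        rw [← hU00]; exact (Continuous.tendsto (by fun_prop) 0)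
      have h3 : Tendsto (fun η => -(U (-η) / d j)) (𝓝 0) (𝓝 (-(u₀ / d j))) := by
        have : Continuous fun η => -(U (-η) / d j) := by fun_prop
        simpa [hU00] using this.tendsto 0
      have := ((hc.tendsto.comp h2).sub (hc.tendsto.comp h3)).const_mul (s j * (d j)⁻¹)
      rw [sub_self, mul_zero] at this
      rw [zero_mul]
      exact this.mono_left nhdsWithin_le_nhds
  have hfin := tendsto_nhds_unique ((tendsto_finsetSum Finset.univ fun j _ => hlim j).congr' hzero)
    tendsto_const_nhds
  rw [← Finset.sum_mul] at hfin
  refine (mul_eq_zero.1 hfin).resolve_right ?_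
  simp [Real.pi_ne_zero]

/-! ### Integration of the logarithmic derivative in a sector -/

/-- The product of `y` with `exp (-∫ p)` has zero derivative. Extending `p` by constants beyond the
interval makes the integral differentiable at the endpoints as well. -/
theorem eq_mul_exp_integral {y p : ℝ → ℂ} {a b : ℝ} (hab : a ≤ b)
    (hp : ContinuousOn p (Set.Icc a b)) (hy : ∀ x ∈ Set.Icc a b, HasDerivAt y (p x * y x) x) :
    y b = y a * Complex.exp (∫ x in a..b, p x) := by
  set P : ℝ → ℂ := Set.IccExtend hab ((Set.Icc a b).domRestrict p) with hP
  have hPc : Continuous P := (continuousOn_iff_continuous_domRestrict.1 hp).Icc_extend'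
  have hPp : ∀ x ∈ Set.Icc a b, P x = p x := fun x hx => by
    rw [hP, Set.IccExtend_of_mem hab _ hx, Set.domRestrict_apply]
  have hint : (∫ x in a..b, p x) = ∫ x in a..b, P x :=
    intervalIntegral.integral_congr fun x hx => by
      rw [Set.uIcc_of_le hab] at hx
      exact (hPp x hx).symm
  have hderiv : ∀ x ∈ Set.Icc a b,
      HasDerivAt (fun x => y x * Complex.exp (-∫ s in a..x, P s)) 0 x := fun x hx => by
    have h1 := (hPc.integral_hasStrictDerivAt a x).hasDerivAt.neg.cexp
    refine ((hy x hx).mul h1).congr_deriv ?_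
    rw [hPp x hx]
    simp only [Pi.neg_apply]
    ring
  have hconst := constant_of_has_deriv_right_zero
    (fun x hx => (hderiv x hx).continuousAt.continuousWithinAt)
    (fun x hx => (hderiv x ⟨hx.1, hx.2.le⟩).hasDerivWithinAt) b ⟨hab, le_rfl⟩
  simp only [intervalIntegral.integral_same, neg_zero, Complex.exp_zero, mul_one] at hconst
  rw [hint, ← hconst, mul_assoc, ← Complex.exp_add, neg_add_cancel, Complex.exp_zero, mul_one]

/-- A function on a half-strip whose logarithmic derivative is small at infinity has a nonzero
limit. -/
theorem exists_tendstoUniformlyOn_strip {F P : ℂ → ℂ} {α β T : ℝ} {b : ℝ → ℝ} (hαβ : α ≤ β)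
    (hF : ∀ t ≥ T, ∀ φ ∈ Set.Icc α β, HasDerivAt F (P (t + φ * Complex.I) * F (t + φ * Complex.I))
      (t + φ * Complex.I))
    (hF0 : ∀ t ≥ T, ∀ φ ∈ Set.Icc α β, F (t + φ * Complex.I) ≠ 0)
    (hP : ∀ t ≥ T, ∀ φ ∈ Set.Icc α β, ContinuousAt P (t + φ * Complex.I))
    (hPb : ∀ t ≥ T, ∀ φ ∈ Set.Icc α β, ‖P (t + φ * Complex.I)‖ ≤ b t)
    (hb : MeasureTheory.IntegrableOn b (Set.Ioi T)) (hb0 : Tendsto b atTop (𝓝 0)) :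
    ∃ K : ℂ, K ≠ 0 ∧ TendstoUniformlyOn (fun t φ : ℝ => F (t + φ * Complex.I)) (fun _ => K) atTop
      (Set.Icc α β) := by
  have hα : α ∈ Set.Icc α β := ⟨le_rfl, hαβ⟩
  have hpc : ContinuousOn (fun t : ℝ => P (t + α * Complex.I)) (Set.Ici T) := fun t ht =>
    (ContinuousAt.comp (f := fun t : ℝ => (t : ℂ) + α * Complex.I) (hP t ht α hα)
      (by fun_prop)).continuousWithinAt
  have hhor : ∀ t ≥ T, F (t + α * Complex.I)
      = F (T + α * Complex.I) * Complex.exp (∫ x in T..t, P (x + α * Complex.I)) := fun t ht => by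
    refine eq_mul_exp_integral (y := fun t : ℝ => F (t + α * Complex.I)) ht
      (hpc.mono Set.Icc_subset_Ici_self) fun x hx => ?_
    have h1 : HasDerivAt (fun t : ℝ => (t : ℂ) + α * Complex.I) 1 x :=
      (Complex.ofRealCLM.hasDerivAt (x := x)).add_const _
    have := (hF x hx.1 α hα).comp x h1
    rwa [mul_one] at this
  have hpi : MeasureTheory.IntegrableOn (fun t : ℝ => P (t + α * Complex.I)) (Set.Ioi T) := by
    refine MeasureTheory.Integrable.mono' hb
      ((hpc.mono Set.Ioi_subset_Ici_self).aestronglyMeasurable measurableSet_Ioi) ?_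
    filter_upwards [MeasureTheory.ae_restrict_mem measurableSet_Ioi] with t ht
    exact hPb t (Set.mem_Ioi.1 ht).le α hα
  -- The limit is computed along the lower edge `φ = α`. Moving up to any other `φ` costs a factor
  -- `exp Q` with `‖Q‖ ≤ b t * (β - α) → 0`, which gives uniformity.
  set K := F (T + α * Complex.I) * Complex.exp (∫ x in Set.Ioi T, P (x + α * Complex.I)) with hK
  have hlim : Tendsto (fun t : ℝ => F (t + α * Complex.I)) atTop (𝓝 K) := by
    have h1 := MeasureTheory.intervalIntegral_tendsto_integral_Ioi T hpi tendsto_id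
    refine ((h1.cexp).const_mul (F (T + α * Complex.I))).congr' ?_
    filter_upwards [eventually_ge_atTop T] with t ht
    exact (hhor t ht).symm
  refine ⟨K, mul_ne_zero (hF0 T le_rfl α hα) (Complex.exp_ne_zero _), ?_⟩
  have hver : ∀ t ≥ T, ∀ φ ∈ Set.Icc α β, ∃ Q : ℂ,
      F (t + φ * Complex.I) = F (t + α * Complex.I) * Complex.exp Q ∧ ‖Q‖ ≤ b t * (β - α) := by
    intro t ht φ hφ
    have hsub : ∀ x ∈ Set.Icc α φ, x ∈ Set.Icc α β := fun x hx => ⟨hx.1, hx.2.trans hφ.2⟩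
    refine ⟨∫ x in α..φ, P (t + x * Complex.I) * Complex.I, ?_, ?_⟩
    · refine eq_mul_exp_integral (y := fun x : ℝ => F (t + x * Complex.I)) hφ.1 (fun x hx => ?_)
        fun x hx => ?_
      · exact ((ContinuousAt.comp (f := fun x : ℝ => (t : ℂ) + x * Complex.I)
          (hP t ht x (hsub x hx)) (by fun_prop)).mul continuousAt_const).continuousWithinAt
      · have h1 : HasDerivAt (fun x : ℝ => (t : ℂ) + x * Complex.I) (1 * Complex.I) x :=
          ((Complex.ofRealCLM.hasDerivAt (x := x)).mul_const _).const_add _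
        have := (hF t ht x (hsub x hx)).comp x h1
        exact this.congr_deriv (by ring)
    · have hbt : 0 ≤ b t := (norm_nonneg _).trans (hPb t ht α hα)
      have h1 := intervalIntegral.norm_integral_le_of_norm_le_const (a := α) (b := φ) (C := b t)
        (f := fun x : ℝ => P (t + x * Complex.I) * Complex.I) fun x hx => by
          rw [Set.uIoc_of_le hφ.1] at hx
          rw [norm_mul, Complex.norm_I, mul_one]
          exact hPb t ht x (hsub x ⟨hx.1.le, hx.2⟩)
      refine h1.trans (mul_le_mul_of_nonneg_left ?_ hbt)
      rw [abs_of_nonneg (by linarith [hφ.1])]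
      linarith [hφ.2]
  have hη : Tendsto (fun t => b t * (β - α)) atTop (𝓝 0) := by simpa using hb0.mul_const (β - α)
  have hmaj : Tendsto (fun t : ℝ => ‖F (t + α * Complex.I)‖ * (2 * (b t * (β - α)))
      + ‖F (t + α * Complex.I) - K‖) atTop (𝓝 0) := by
    have h1 := (hlim.norm.mul (hη.const_mul 2)).add (hlim.sub_const K).norm
    simpa using h1
  rw [Metric.tendstoUniformlyOn_iff]
  intro ε hε
  filter_upwards [hmaj.eventually_lt_const hε, hη.eventually_le_const one_pos,
    eventually_ge_atTop T] with t ht1 ht2 ht φ hφ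
  obtain ⟨Q, hQ, hQb⟩ := hver t ht φ hφ
  rw [dist_comm, dist_eq_norm, hQ]
  refine lt_of_le_of_lt ?_ ht1
  calc ‖F (t + α * Complex.I) * Complex.exp Q - K‖
      = ‖F (t + α * Complex.I) * (Complex.exp Q - 1) + (F (t + α * Complex.I) - K)‖ := by ring_nf
    _ ≤ ‖F (t + α * Complex.I)‖ * ‖Complex.exp Q - 1‖ + ‖F (t + α * Complex.I) - K‖ := by
      rw [← norm_mul]; exact norm_add_le _ _
    _ ≤ _ := by
      gcongr
      exact (Complex.norm_exp_sub_one_le (hQb.trans ht2)).trans (by gcongr)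

/-- Uniform asymptotics of the Mittag-Leffler sum of a branch in a closed sector not containing
the direction of the branch, in logarithmic coordinates. -/
theorem IsAsymptoticBranch.exists_sector_bound {a : ℕ → ℂ} {d ξ : ℂ} (h : IsAsymptoticBranch a d ξ)
    {α β : ℝ} (hoff : ∀ φ ∈ Set.Icc α β, (Complex.exp (φ * Complex.I)).arg ≠ d.arg) :
    ∃ b : ℝ → ℝ, (∀ T, MeasureTheory.IntegrableOn b (Set.Ioi T)) ∧ Tendsto b atTop (𝓝 0) ∧
      ∀ᶠ t : ℝ in atTop, ∀ φ ∈ Set.Icc α β,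
        (∀ m, a m ≠ Complex.exp (t + φ * Complex.I)) ∧
        ‖Complex.exp (t + φ * Complex.I) * (branchSum a d (Complex.exp (t + φ * Complex.I))
          - branchSum (fun m => d * ((m : ℂ) + 1)) d (Complex.exp (t + φ * Complex.I))) + ξ‖
            ≤ b t := by
  have hΓ : IsCompact ((fun φ : ℝ => Complex.exp (φ * Complex.I)) '' Set.Icc α β) :=
    isCompact_Icc.image (by fun_prop)
  obtain ⟨c, hc, hcb⟩ := exists_pos_le_norm_sub hΓ h.1
    (by rintro u ⟨φ, -, rfl⟩; exact Complex.norm_exp_ofReal_mul_I φ)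
    (by rintro u ⟨φ, hφ, rfl⟩; exact hoff φ hφ)
  obtain ⟨δ, C, ρ, hδ, hC, hρ, hS⟩ := h.exists_branchSum_sub_le hc
  -- At `‖z‖ = exp t`, the factor `z` turns the error `C * ‖z‖ ^ (-(1 + δ))` into `C * exp (-δ t)`.
  refine ⟨fun t => C * Real.exp (-δ * t), fun T => (exp_neg_integrableOn_Ioi T hδ).const_mul C,
    ?_, ?_⟩
  · have h1 : Tendsto (fun t : ℝ => -δ * t) atTop atBot :=
      tendsto_id.const_mul_atTop_of_neg (by linarith)
    simpa using (Real.tendsto_exp_atBot.comp h1).const_mul C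
  · filter_upwards [Real.tendsto_exp_atTop.eventually_ge_atTop ρ] with t ht φ hφ
    have e : Complex.exp (t + φ * Complex.I) = (Real.exp t : ℝ) * Complex.exp (φ * Complex.I) := by
      rw [Complex.exp_add, Complex.ofReal_exp]
    have hn : ‖Complex.exp (t + φ * Complex.I)‖ = Real.exp t := by
      rw [e, norm_mul, Complex.norm_exp_ofReal_mul_I, mul_one,
        Complex.norm_of_nonneg (Real.exp_pos t).le]
    have haw : AwayFromRay c d (Complex.exp (t + φ * Complex.I)) := by
      rw [e]
      exact AwayFromRay.of_ray (Complex.norm_exp_ofReal_mul_I φ) (Real.exp_pos t).le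
        (hcb _ ⟨φ, hφ, rfl⟩)
    obtain ⟨h1, h2⟩ := hS _ (by rwa [hn]) haw
    refine ⟨h1, ?_⟩
    set z := Complex.exp (t + φ * Complex.I)
    have hz : z ≠ 0 := Complex.exp_ne_zero _
    have e2 : z * (branchSum a d z - branchSum (fun m => d * ((m : ℂ) + 1)) d z) + ξ
        = z * (branchSum a d z - branchSum (fun m => d * ((m : ℂ) + 1)) d z + ξ / z) := by
      field_simp
    rw [e2, norm_mul, hn]
    rw [hn] at h2
    refine (mul_le_mul_of_nonneg_left h2 (Real.exp_pos t).le).trans (le_of_eq ?_)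
    rw [← Real.exp_mul, mul_left_comm, ← Real.exp_add]
    ring_nf

/-! ### Matching of the branches -/

theorem exists_unit_arg_ne {ι : Type*} [Finite ι] (d : ι → ℂ) :
    ∃ u : ℂ, ‖u‖ = 1 ∧ ∀ j, u.arg ≠ (d j).arg := by
  obtain ⟨θ, hθ, hne⟩ := (Set.Ioc_infinite (neg_lt_self Real.pi_pos)).exists_notMem_finite
    (Set.finite_range fun j => (d j).arg)
  refine ⟨Complex.exp (θ * Complex.I), Complex.norm_exp_ofReal_mul_I θ, fun j hj => hne ⟨j, ?_⟩⟩
  beta_reduce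
  rw [← hj, Complex.arg_exp_mul_I, toIocMod_eq_self Real.two_pi_pos |>.2]
  rwa [show -Real.pi + 2 * Real.pi = Real.pi by ring]

/-- Equal arguments make the ratio `d i / d j` real, which non-overlap forbids for distinct
branches. -/
theorem IsChristmasTree.eq_of_arg_eq {S : Set ℂ} {M : ℕ} {ω : Fin M → ℕ → ℂ} {d ξ : Fin M → ℂ}
    (h : IsChristmasTree S ω d ξ) {i j : Fin M} (hij : (d i).arg = (d j).arg) : i = j := by
  by_contra hne
  apply h.non_overlapping i j hne
  have h1 := (Complex.arg_eq_arg_iff (h.branch j).1 (h.branch i).1).1 hij.symm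
  rw [← h1, mul_div_cancel_right₀ _ (h.branch j).1, ← Complex.ofReal_div, Complex.ofReal_im]

open Classical in
-- Each sum has at most one term. The left one is `(d i)⁻¹ ≠ 0`, so the right one cannot be empty,
-- and the two inverses coincide.
theorem IsChristmasTree.exists_eq_of_sum_eq_zero {S S' : Set ℂ} {M M' : ℕ} {ω : Fin M → ℕ → ℂ}
    {d ξ : Fin M → ℂ} {ω' : Fin M' → ℕ → ℂ} {d' ξ' : Fin M' → ℂ}
    (h : IsChristmasTree S ω d ξ) (h' : IsChristmasTree S' ω' d' ξ') (i : Fin M)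
    (hsum : (∑ j, if (d j).arg = (d i).arg then (d j)⁻¹ else 0)
      = ∑ j, if (d' j).arg = (d i).arg then (d' j)⁻¹ else 0) : ∃ j, d i = d' j := by
  rw [Finset.sum_eq_single_of_mem i (Finset.mem_univ i), if_pos rfl] at hsum
  · by_cases hex : ∃ j, (d' j).arg = (d i).arg
    · obtain ⟨j, hj⟩ := hex
      rw [Finset.sum_eq_single_of_mem j (Finset.mem_univ j), if_pos hj] at hsum
      · exact ⟨j, inv_injective hsum⟩
      · intro k _ hk
        exact if_neg fun hk' => hk (h'.eq_of_arg_eq (hk'.trans hj.symm))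
    · push Not at hex
      rw [Finset.sum_eq_zero fun j _ => if_neg (hex j)] at hsum
      exact absurd hsum (inv_ne_zero (h.branch i).1)
  · intro k _ hk
    exact if_neg fun hk' => hk (h.eq_of_arg_eq hk')

open Classical in
/-- The branches of poles and zeroes match, and the logarithmic derivative is the sum over matched
branches of the differences of Mittag-Leffler sums. -/
theorem exists_matching_and_logDeriv_eq (G : ℂ → ℂ) (hG : IsMeromorphicSimple G) {Mp Mm : ℕ}
    (ωp : Fin Mp → ℕ → ℂ) (dp ξp : Fin Mp → ℂ) (ωm : Fin Mm → ℕ → ℂ) (dm ξm : Fin Mm → ℂ)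
    (hp : IsChristmasTree (poleSet G) ωp dp ξp) (hm : IsChristmasTree (zeroSet G) ωm dm ξm)
    (hpow : HasPowerLawAsymptotics G dp dm) :
    ∃ e : Fin Mp ≃ Fin Mm, (∀ j, dp j = dm (e j)) ∧ ∀ z, meromorphicOrderAt G z = 0 →
      logDeriv G z = ∑ j, (branchSum (ωm (e j)) (dp j) z - branchSum (ωp j) (dp j) z) := by
  obtain ⟨R, hR, hRt, hcirc, ⟨C, k, hC⟩, hray⟩ := hpow
  set a : Fin Mm ⊕ Fin Mp → ℕ → ℂ := Sum.elim ωm ωp with ha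
  set d : Fin Mm ⊕ Fin Mp → ℂ := Sum.elim dm dp with hd
  set ξ : Fin Mm ⊕ Fin Mp → ℂ := Sum.elim ξm ξp with hξ
  set s : Fin Mm ⊕ Fin Mp → ℂ := Sum.elim (fun _ => 1) (fun _ => -1) with hs
  have hbr : ∀ j, IsAsymptoticBranch (a j) (d j) (ξ j) := by
    rintro (j | j)
    exacts [hm.branch j, hp.branch j]
  have hinj : ∀ j, Function.Injective (a j) := by
    rintro (j | j) m n hmn
    · simpa using hm.injective (a₁ := (j, m)) (a₂ := (j, n)) hmn
    · simpa using hp.injective (a₁ := (j, m)) (a₂ := (j, n)) hmn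
  have hord : ∀ z, (∀ j m, a j m ≠ z) ↔ meromorphicOrderAt G z = 0 := by
    intro z
    have h1 := hm.mem_iff z
    have h2 := hp.mem_iff z
    simp only [zeroSet, poleSet, Set.mem_ofPred_eq] at h1 h2
    constructor
    · intro h
      have h1' : ¬ 0 < meromorphicOrderAt G z := fun hlt => by
        obtain ⟨j, m, hjm⟩ := h1.1 hlt
        exact h (Sum.inl j) m hjm
      have h2' : ¬ meromorphicOrderAt G z < 0 := fun hlt => by
        obtain ⟨j, m, hjm⟩ := h2.1 hlt
        exact h (Sum.inr j) m hjm
      exact le_antisymm (not_lt.1 h1') (not_lt.1 h2')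
    · rintro h (j | j) m hjm
      · exact (h1.2 ⟨j, m, hjm⟩).ne' h
      · exact (h2.2 ⟨j, m, hjm⟩).ne h
  have hres : ∀ {M : ℕ} {S : Set ℂ} {ω : Fin M → ℕ → ℂ} {d ξ : Fin M → ℂ},
      IsChristmasTree S ω d ξ → ∀ z, (∑ j, if ∃ m, ω j m = z then (1 : ℂ) else 0)
        = if z ∈ S then 1 else 0 := by
    intro M S ω d ξ h z
    split_ifs with hz
    · obtain ⟨j, m, hjm⟩ := (h.mem_iff z).1 hz
      rw [Finset.sum_eq_single_of_mem j (Finset.mem_univ j), if_pos ⟨m, hjm⟩]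
      rintro i - hij
      refine if_neg ?_
      rintro ⟨n, hn⟩
      have := h.injective (a₁ := (i, n)) (a₂ := (j, m)) (hn.trans hjm.symm)
      exact hij (Prod.mk.inj this).1
    · refine Finset.sum_eq_zero fun j _ => if_neg ?_
      rintro ⟨m, hm⟩
      exact hz ((h.mem_iff z).2 ⟨j, m, hm⟩)
  have hloc : ∀ z₀, ∃ g : ℂ → ℂ, AnalyticAt ℂ g z₀ ∧ logDeriv G =ᶠ[𝓝[≠] z₀]
      fun z => g z + (∑ j, s j * if ∃ m, a j m = z₀ then 1 else 0) * (z - z₀)⁻¹ := by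
    intro z₀
    have hsum : (∑ j, s j * if ∃ m, a j m = z₀ then 1 else 0)
        = (if z₀ ∈ zeroSet G then (1 : ℂ) else 0) - if z₀ ∈ poleSet G then 1 else 0 := by
      rw [Fintype.sum_sum_type, ← hres hm, ← hres hp]
      simp only [hs, ha, Sum.elim_inl, Sum.elim_inr, one_mul, neg_mul, Finset.sum_neg_distrib,
        sub_eq_add_neg]
    have hmer := (hG.1 (Set.mem_univ z₀)).meromorphicAt
    rw [hsum]
    rcases hG.2 z₀ with h | h | h
    · obtain ⟨g, hg, hge⟩ := exists_logDeriv_eq_add hmer (n := -1) (by simpa using h)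
      refine ⟨g, hg, ?_⟩
      have h1 : z₀ ∉ zeroSet G := by
        show ¬ 0 < meromorphicOrderAt G z₀
        rw [h]; decide
      have h2 : z₀ ∈ poleSet G := by
        show meromorphicOrderAt G z₀ < 0
        rw [h]; decide
      rw [if_neg h1, if_pos h2]
      simpa using hge
    · obtain ⟨g, hg, hge⟩ := exists_logDeriv_eq_add hmer (n := 0) (by simpa using h)
      refine ⟨g, hg, ?_⟩
      have h1 : z₀ ∉ zeroSet G := by
        show ¬ 0 < meromorphicOrderAt G z₀
        rw [h]; decide
      have h2 : z₀ ∉ poleSet G := by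
        show ¬ meromorphicOrderAt G z₀ < 0
        rw [h]; decide
      rw [if_neg h1, if_neg h2]
      simpa using hge
    · obtain ⟨g, hg, hge⟩ := exists_logDeriv_eq_add hmer (n := 1) (by simpa using h)
      refine ⟨g, hg, ?_⟩
      have h1 : z₀ ∈ zeroSet G := by
        show 0 < meromorphicOrderAt G z₀
        rw [h]; decide
      have h2 : z₀ ∉ poleSet G := by
        show ¬ meromorphicOrderAt G z₀ < 0
        rw [h]; decide
      rw [if_pos h1, if_neg h2]
      simpa using hge
  have hreg : ∀ z₀, (∀ j m, a j m ≠ z₀) → AnalyticAt ℂ (logDeriv G) z₀ := fun z₀ hz => by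
    obtain ⟨h1, h2⟩ := hG.analyticAt ((hord z₀).1 hz)
    exact h1.deriv.div h1 h2
  obtain ⟨p, hpE⟩ := exists_partialFraction hbr hinj hloc hreg hR hRt
    (fun N j m h => (hord _).2 (hcirc N _ h) j m rfl) hC
  set L := ∑ j, s j * (d j)⁻¹ with hL
  have hlim : ∀ u : ℂ, ‖u‖ = 1 → (∀ j, u.arg ≠ (d j).arg) →
      ∃ e : ℂ, p = Polynomial.C e ∧ L = 0 ∧ e + ∑ j, s j * ((d j)⁻¹ *
        (Complex.log (-(u / d j)) + Real.eulerMascheroniConstant)) = 0 := by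
    intro u hu harg
    refine Polynomial.eq_C_of_tendsto_add_log (norm_pos_iff.1 (by rw [hu]; exact one_pos)) hRt ?_
    obtain ⟨C', hC'⟩ := hray u hu (fun j => harg (Sum.inr j)) fun j => harg (Sum.inl j)
    have hf : Tendsto (fun N => logDeriv G (R N * u)) atTop (𝓝 0) := by
      refine squeeze_zero_norm hC' ?_
      simpa [div_eq_mul_inv] using hRt.inv_tendsto_atTop.const_mul C'
    have hS := fun j => (((hbr j).tendsto_branchSum_ray hu (harg j)).2.comp hRt).const_mul (s j)
    have h1 := hf.sub (tendsto_finsetSum Finset.univ fun j _ => hS j)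
    simp only [mul_zero, Finset.sum_const_zero, sub_zero] at h1
    refine h1.congr fun N => ?_
    have hN : ∀ j m, a j m ≠ R N * u := (hord _).2 (hcirc N _ (by
      rw [norm_mul, hu, mul_one, Complex.norm_of_nonneg (hR N).le]))
    rw [hpE _ hN, hL, Finset.mul_sum, ← Finset.sum_add_distrib, add_sub_assoc,
      ← Finset.sum_sub_distrib]
    congr 1
    refine Finset.sum_congr rfl fun j _ => ?_
    simp only [Function.comp_apply]
    ring
  obtain ⟨u, hu, hu_arg⟩ := exists_unit_arg_ne d
  obtain ⟨e₀, hpe, hL0, he₀⟩ := hlim u hu hu_arg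
  have hjump := sum_div_eq_zero_of_log_relation (fun j => (hbr j).1)
    (e := e₀) (γ := Real.eulerMascheroniConstant) (s := s) fun v hv hv_arg => by
      -- The constant is that of the single polynomial `p`, so it does not depend on the direction.
      obtain ⟨e₁, hpe₁, -, he₁⟩ := hlim v hv hv_arg
      rwa [Polynomial.C_injective (hpe.symm.trans hpe₁)]
  have hjump' : ∀ i, (∑ j, if (dm j).arg = (d i).arg then (dm j)⁻¹ else 0)
      = ∑ j, if (dp j).arg = (d i).arg then (dp j)⁻¹ else 0 := fun i => by
    have h1 := hjump i
    rw [Fintype.sum_sum_type] at h1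
    have h2 : (∑ j, if (d (Sum.inr j)).arg = (d i).arg then s (Sum.inr j) * (d (Sum.inr j))⁻¹
        else 0) = -∑ j, if (dp j).arg = (d i).arg then (dp j)⁻¹ else 0 := by
      rw [← Finset.sum_neg_distrib]
      refine Finset.sum_congr rfl fun j _ => ?_
      simp only [hd, hs, Sum.elim_inr]
      split_ifs <;> simp
    rw [h2, add_neg_eq_zero] at h1
    rw [← h1]
    simp [hd, hs]
  choose e he using fun i : Fin Mp =>
    hp.exists_eq_of_sum_eq_zero hm i (hjump' (Sum.inr i)).symm
  have hbij : Function.Bijective e := by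
    refine ⟨fun i j hij => hp.eq_of_arg_eq (by rw [he i, he j, hij]), fun i => ?_⟩
    obtain ⟨j, hj⟩ := hm.exists_eq_of_sum_eq_zero hp i (hjump' (Sum.inl i))
    exact ⟨j, hm.eq_of_arg_eq (by rw [← he j, ← hj])⟩
  -- Matched branches carry the same `d` and opposite residues, so anything depending on `d` alone
  -- cancels; this kills the remaining constant.
  have hsplit : ∀ F : ℂ → ℂ, ∑ j, s j * F (d j) = 0 := fun F => by
    rw [Fintype.sum_sum_type, ← (Equiv.ofBijective e hbij).sum_comp]
    simp [hs, hd, he]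
  have he00 : e₀ = 0 := by
    rw [hsplit fun x => x⁻¹ * (Complex.log (-(u / x)) + Real.eulerMascheroniConstant),
      add_zero] at he₀
    exact he₀
  refine ⟨Equiv.ofBijective e hbij, he, fun z hz => ?_⟩
  rw [hpE z ((hord z).2 hz), hpe, he00, Polynomial.eval_C, zero_add, Fintype.sum_sum_type,
    ← (Equiv.ofBijective e hbij).sum_comp, ← Finset.sum_add_distrib]
  refine Finset.sum_congr rfl fun j _ => ?_
  simp only [hs, ha, hd, Sum.elim_inl, Sum.elim_inr, Equiv.ofBijective_apply, ← he j]
  ring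

/-! ### Conclusion -/

theorem mainTheorem6 (G : ℂ → ℂ) (hG : IsMeromorphicSimple G) {Mp Mm : ℕ}
    (ωp : Fin Mp → ℕ → ℂ) (dp ξp : Fin Mp → ℂ) (ωm : Fin Mm → ℕ → ℂ) (dm ξm : Fin Mm → ℂ)
    (hp : IsChristmasTree (poleSet G) ωp dp ξp) (hm : IsChristmasTree (zeroSet G) ωm dm ξm)
    (hpow : HasPowerLawAsymptotics G dp dm) :
    ∃ e : Fin Mp ≃ Fin Mm, (∀ j, dp j = dm (e j)) ∧
      ∀ σ : ℂ, σ = ∑ j, (ξm (e j) - ξp j) →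
        ∀ α β : ℝ, (∀ φ ∈ Set.Icc α β, OffBranches dp (Complex.exp (φ * Complex.I))) →
          ∃ K : ℂ, K ≠ 0 ∧
            TendstoUniformlyOn
              (fun (r φ : ℝ) => G (r * Complex.exp (φ * Complex.I)) *
                Complex.exp (σ * (Real.log r + φ * Complex.I)))
              (fun _ => K) atTop (Set.Icc α β) := by
  obtain ⟨e, he, hlog⟩ := exists_matching_and_logDeriv_eq G hG ωp dp ξp ωm dm ξm hp hm hpow
  refine ⟨e, he, fun σ hσ α β hoff => ?_⟩
  rcases lt_or_ge β α with hαβ | hαβ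
  · exact ⟨1, one_ne_zero, by rw [Set.Icc_eq_empty (not_le.2 hαβ)]; exact tendstoUniformlyOn_empty⟩
  have hbm : ∀ j, IsAsymptoticBranch (ωm (e j)) (dp j) (ξm (e j)) := fun j => by
    rw [he j]; exact hm.branch (e j)
  choose bp hbp_int hbp_lim hbp using fun j =>
    (hp.branch j).exists_sector_bound fun φ hφ => hoff φ hφ j
  choose bm hbm_int hbm_lim hbm' using fun j =>
    (hbm j).exists_sector_bound fun φ hφ => hoff φ hφ j
  set b : ℝ → ℝ := fun t => ∑ j, (bm j t + bp j t) with hb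
  have hb_int : ∀ T, MeasureTheory.IntegrableOn b (Set.Ioi T) := fun T =>
    MeasureTheory.integrable_finsetSum _ fun j _ => (hbm_int j T).add (hbp_int j T)
  have hb_lim : Tendsto b atTop (𝓝 0) := by
    simpa using tendsto_finsetSum Finset.univ fun j _ => (hbm_lim j).add (hbp_lim j)
  obtain ⟨T, hT⟩ := eventually_atTop.1 ((eventually_all.2 hbp).and (eventually_all.2 hbm'))
  have hord : ∀ t ≥ T, ∀ φ ∈ Set.Icc α β,
      meromorphicOrderAt G (Complex.exp (t + φ * Complex.I)) = 0 := fun t ht φ hφ => by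
    refine le_antisymm (not_lt.1 fun hlt => ?_) (not_lt.1 fun hlt => ?_)
    · obtain ⟨j, m, hjm⟩ := (hm.mem_iff _).1 hlt
      exact ((hT t ht).2 (e.symm j) φ hφ).1 m (by rw [e.apply_symm_apply, hjm])
    · obtain ⟨j, m, hjm⟩ := (hp.mem_iff _).1 hlt
      exact ((hT t ht).1 j φ hφ).1 m hjm
  -- The logarithmic derivative of `G (exp w) * exp (σ * w)` in `w` is `z G'(z) / G(z) + σ` with `z
  -- = exp w`.
  obtain ⟨K, hK, hlim⟩ := exists_tendstoUniformlyOn_strip (T := T) (b := b) hαβ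
    (F := fun w => G (Complex.exp w) * Complex.exp (σ * w))
    (P := fun w => Complex.exp w * logDeriv G (Complex.exp w) + σ)
    (fun t ht φ hφ => by
      obtain ⟨h1, h2⟩ := hG.analyticAt (hord t ht φ hφ)
      set w : ℂ := t + φ * Complex.I
      have h3 := (h1.differentiableAt.hasDerivAt.comp w (Complex.hasDerivAt_exp w)).mul
        (((hasDerivAt_id w).const_mul σ).cexp)
      refine h3.congr_deriv ?_
      simp only [logDeriv_apply, Function.comp_apply, id]
      field_simp)
    (fun t ht φ hφ => mul_ne_zero (hG.analyticAt (hord t ht φ hφ)).2 (Complex.exp_ne_zero _))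
    (fun t ht φ hφ => by
      obtain ⟨h1, h2⟩ := hG.analyticAt (hord t ht φ hφ)
      have h3 : ContinuousAt (logDeriv G) (Complex.exp (t + φ * Complex.I)) :=
        (h1.deriv.div h1 h2).continuousAt
      exact (Complex.continuous_exp.continuousAt.mul
        (h3.comp Complex.continuous_exp.continuousAt)).add continuousAt_const)
    (fun t ht φ hφ => by
      set z := Complex.exp (t + φ * Complex.I) with hz
      -- The sum over the exact progression is common to both members of a pair and may be inserted
      -- freely; `σ` supplies the shifts `ξ` that make each bracket small.
      have h1 : z * logDeriv G z + σ = ∑ j,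
          ((z * (branchSum (ωm (e j)) (dp j) z
              - branchSum (fun m => dp j * ((m : ℂ) + 1)) (dp j) z) + ξm (e j))
            - (z * (branchSum (ωp j) (dp j) z
              - branchSum (fun m => dp j * ((m : ℂ) + 1)) (dp j) z) + ξp j)) := by
        rw [hlog z (hord t ht φ hφ), hσ, Finset.mul_sum, ← Finset.sum_add_distrib]
        exact Finset.sum_congr rfl fun j _ => by ring
      rw [h1]
      exact (norm_sum_le _ _).trans (Finset.sum_le_sum fun j _ => (norm_sub_le _ _).trans
        (add_le_add ((hT t ht).2 j φ hφ).2 ((hT t ht).1 j φ hφ).2)))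
    (hb_int T) hb_lim
  refine ⟨K, hK, fun U hU => ?_⟩
  filter_upwards [Real.tendsto_log_atTop.eventually (hlim U hU), eventually_gt_atTop 0]
    with r hr hr0 φ hφ
  have h1 := hr φ hφ
  have h2 : Complex.exp ((Real.log r : ℝ) + φ * Complex.I) = r * Complex.exp (φ * Complex.I) := by
    rw [Complex.exp_add, ← Complex.ofReal_exp, Real.exp_log hr0]
  simpa only [h2] using h1
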